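/- Let $n\in\{2,3\}$, $\Omega=(\mathbb R/\mathbb Z)^n$ (so $|\Omega|=1$), $k\in\mathbb R$, and let $\gamma:[0,\infty)\to[0,\infty)$ be non-increasing and of class $C^2$ on $(0,\infty)$, with $M_\gamma:=\sup_{s\ge 0}\gamma(s)$. Put $G(s)=\tfrac12 s^2-\tfrac13 s^3$ and $W(s)=\tfrac12 s^2(1-s)^2$. For each $\varepsilon\in(0,1)$ let $\varphi_0^\varepsilon\in C^1(\Omega)$ satisfy $0<\varphi_0^\varepsilon<1$ and let $u_0^\varepsilon\in C(\Omega)$ satisfy $u_0^\varepsilon\ge 0$, and suppose $$\sup_{0<\varepsilon<1}\int_\Omega\Big(\frac{\varepsilon|\nabla\varphi_0^\varepsilon|^2}{2}+\frac{W(\varphi_0^\varepsilon)}{2\varepsilon}\Big)\,dx<\infty .$$ For $T,\alpha>0$ and $\varepsilon\in(0,1)$, a pair $(\varphi^\varepsilon,u^\varepsilon)$ is called a classical solution on $\Omega\times[0,T)$ if both functions are continuous on $\Omega\times[0,T)$ and of class $C^{2,1}$ on $\Omega\times(0,T)$, $\nabla\varphi^\varepsilon$ is continuous on $\Omega\times[0,T)$,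 and $$\varepsilon^2\varphi^\varepsilon_t=\varepsilon^2\Delta\varphi^\varepsilon-\tfrac12W'(\varphi^\varepsilon)-\varepsilon G'(\varphi^\varepsilon)\big(-\gamma(u^\varepsilon)+\tilde S[\varphi^\varepsilon](t)\big),\qquad u^\varepsilon_t=\Delta u^\varepsilon-ku^\varepsilon+\varphi^\varepsilon\qquad\text{in }\Omega\times(0,T),$$ with $\varphi^\varepsilon|_{t=0}=\varphi_0^\varepsilon$ and $u^\varepsilon|_{t=0}=u_0^\varepsilon$, where $$\tilde S[\varphi^\varepsilon](t)=\alpha\Big(\int_\Omega G(\varphi^\varepsilon(x,t))\,dx-\int_\Omega G(\varphi_0^\varepsilon(x))\,dx\Big).$$ Its energy is $$E(t)=\int_\Omega\Big(\frac{\varepsilon|\nabla\varphi^\varepsilon|^2}{2}+\frac{W(\varphi^\varepsilon)}{2\varepsilon}\Big)dx+\frac{\alpha}{2}\Big(\int_\Omega G(\varphi^\varepsilon)\,dx-\int_\Omega G(\varphi_0^\varepsilon)\,dx\Big)^2 .$$ Assume that there exists $C_1>0$ such that for all $\varepsilon\in(0,1)$ $$1-\frac{6}{|\Omega|}\int_\Omega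 G(\varphi_0^\varepsilon)\,dx\ge C_1,\qquad \int_\Omega G(\varphi_0^\varepsilon)\,dx\ge C_1 .$$ Then there exists a constant $C_2>0$, independent of $\varepsilon$, $\alpha$, $T$ and the solution, such that for every $T>0$ there are $\varepsilon_0\in(0,1]$ and $\alpha_0>0$ with the following property: for all $\varepsilon\in(0,\varepsilon_0)$, all $\alpha>\alpha_0$ and every classical solution $(\varphi^\varepsilon,u^\varepsilon)$ on $\Omega\times[0,T)$, the function $t\mapsto|\tilde S[\varphi^\varepsilon](t)|^2$ is integrable on $(0,T)$ and $$\int_0^T|\tilde S[\varphi^\varepsilon](t)|^2\,dt\le C_2\big(1+e^{2M_\gamma^2T}E(0)\big)\big((1+M_\gamma^2)T+C(T)\big),\qquad C(T)=2e^{2M_\gamma^2T}E(0).$$ -/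

import Mathlib

open Set MeasureTheory

noncomputable section

namespace PhaseField

/-- `ℝⁿ` with its Euclidean norm.  Functions on the torus `Ω = (ℝ/ℤ)ⁿ` are represented by
`ℤⁿ`-periodic functions on `ℝⁿ`. -/
abbrev Space (n : ℕ) : Type := EuclideanSpace ℝ (Fin n)

/-- `f` has period one in every coordinate direction, i.e. it descends to `(ℝ/ℤ)ⁿ`. -/
def IsPeriodic {n : ℕ} (f : Space n → ℝ) : Prop :=
  ∀ (i : Fin n) (x : Space n), f (x + EuclideanSpace.single i 1) = f x

/-- The fundamental cell `[0,1)ⁿ` of the torus; integrals over `Ω` are integrals over it. -/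
def cell (n : ℕ) : Set (Space n) := {x | ∀ i, x i ∈ Ico (0 : ℝ) 1}

/-- `|Ω|`. -/
def cellVolume (n : ℕ) : ℝ := volume.real (cell n)

/-- `G(s) = s²/2 - s³/3`. -/
def G (s : ℝ) : ℝ := s ^ 2 / 2 - s ^ 3 / 3

/-- The double-well potential `W(s) = s²(1-s)²/2`. -/
def W (s : ℝ) : ℝ := s ^ 2 * (1 - s) ^ 2 / 2

/-- `∫_Ω G(f) dx`. -/
def intG {n : ℕ} (f : Space n → ℝ) : ℝ := ∫ x in cell n, G (f x)

/-- The nonlocal term `S̃ = α (∫_Ω G(f) dx - ∫_Ω G(f₀) dx)`. -/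
def nonlocalTerm {n : ℕ} (α : ℝ) (f₀ f : Space n → ℝ) : ℝ := α * (intG f - intG f₀)

/-- The surface energy `E_s = ∫_Ω (ε|∇f|²/2 + W(f)/(2ε)) dx`. -/
def surfaceEnergy {n : ℕ} (ε : ℝ) (f : Space n → ℝ) : ℝ :=
  ∫ x in cell n, (ε * ‖gradient f x‖ ^ 2 / 2 + W (f x) / (2 * ε))

/-- The volume penalty `E_p = (α/2) (∫_Ω G(f) dx - ∫_Ω G(f₀) dx)²`. -/
def penaltyEnergy {n : ℕ} (α : ℝ) (f₀ f : Space n → ℝ) : ℝ :=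
  α / 2 * (intG f - intG f₀) ^ 2

/-- The total energy `E = E_s + E_p` of the profile `f`, with initial profile `f₀`. -/
def energy {n : ℕ} (ε α : ℝ) (f₀ f : Space n → ℝ) : ℝ :=
  surfaceEnergy ε f + penaltyEnergy α f₀ f

/-- `M_γ = sup_{s ≥ 0} γ(s)`. -/
def supGamma (γ : ℝ → ℝ) : ℝ := sSup (γ '' Ici 0)

/-- The regularity of a classical solution of a parabolic equation on `Ω × (0,T)`: periodic in
space, continuous on `Ω × [0,T)`, and of class `C^{2,1}` (two continuous space derivatives, one
continuous time derivative) on `Ω × (0,T)`. -/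
structure IsParabolicC21 {n : ℕ} (T : ℝ) (f : ℝ → Space n → ℝ) : Prop where
  periodic : ∀ t ∈ Ico 0 T, IsPeriodic (f t)
  continuousOn : ContinuousOn (fun p : ℝ × Space n => f p.1 p.2) (Ico 0 T ×ˢ univ)
  contDiff_space : ∀ t ∈ Ioo 0 T, ContDiff ℝ 2 (f t)
  continuousOn_gradient :
    ContinuousOn (fun p : ℝ × Space n => gradient (f p.1) p.2) (Ioo 0 T ×ˢ univ)
  continuousOn_hessian :
    ContinuousOn (fun p : ℝ × Space n => iteratedFDeriv ℝ 2 (f p.1) p.2) (Ioo 0 T ×ˢ univ)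
  differentiableAt_time : ∀ t ∈ Ioo 0 T, ∀ x, DifferentiableAt ℝ (fun s => f s x) t
  continuousOn_deriv_time :
    ContinuousOn (fun p : ℝ × Space n => deriv (fun s => f s p.2) p.1) (Ioo 0 T ×ˢ univ)

/-- `(φ, u)` is a classical solution on `Ω × [0,T)` of
`ε² φ_t = ε² Δφ - W'(φ)/2 - ε G'(φ) (-γ(u) + S̃[φ](t))`, `u_t = Δu - k u + φ`,
with initial data `φ₀`, `u₀`.  The `C¹` initial datum of `φ` is attained in `C¹`
(`continuousOn_gradient_zero`), so that the energy is continuous up to the initial time. -/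
structure IsClassicalSolution {n : ℕ} (T ε α k : ℝ) (γ : ℝ → ℝ) (φ₀ u₀ : Space n → ℝ)
    (φ u : ℝ → Space n → ℝ) : Prop where
  regular_phi : IsParabolicC21 T φ
  regular_u : IsParabolicC21 T u
  continuousOn_gradient_zero :
    ContinuousOn (fun p : ℝ × Space n => gradient (φ p.1) p.2) (Ico 0 T ×ˢ univ)
  eq_phi : ∀ t ∈ Ioo 0 T, ∀ x,
    ε ^ 2 * deriv (fun s => φ s x) t =
      ε ^ 2 * (Laplacian.laplacian (φ t) : Space n → ℝ) x - deriv W (φ t x) / 2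
        - ε * deriv G (φ t x) * (-γ (u t x) + nonlocalTerm α φ₀ (φ t))
  eq_u : ∀ t ∈ Ioo 0 T, ∀ x,
    deriv (fun s => u s x) t =
      (Laplacian.laplacian (u t) : Space n → ℝ) x - k * u t x + φ t x
  initial_phi : ∀ x, φ 0 x = φ₀ x
  initial_u : ∀ x, u 0 x = u₀ x

end PhaseField

end

noncomputable section

namespace PhaseField

/-! ### The fundamental cell -/

/-! Write `S` for the nonlocal term, `e` for the surface energy, `D = ε ∫ φ_t²` for the dissipation
and `M` for `supGamma γ`. The equation divided by `ε` expresses `S φ(1-φ)` as `-ε φ_t`, plus the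
first variation of the surface energy with its sign reversed, plus the forcing `γ(u) φ(1-φ)`.
Multiply it by `∇φ · θ` for a periodic vector field `θ` and integrate. Since `φ(1-φ)∇φ = ∇G(φ)`, the
left side becomes `-S ∫ G(φ) div θ`. On the right, the first variation turns into a stress tensor
paired with `∇θ` (`integral_stress`), and Cauchy-Schwarz handles `φ_t`, so everything is bounded by
`√(De)`, `e` and the sup norms of `θ` and `∇θ` (`abs_integral_equation_le`).

The field is chosen with `div θ = f - ∫ f`, where `f` is a mollification of `G(φ)`; both come from
averaging along coordinate segments, with explicit bounds (`exists_mollification`,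
`exists_vectorField`). Then `∫ G(φ) div θ` is close to `∫ G(φ)² - (∫ G(φ))²`. As `G(φ)` lies near
`{0, 1/6}` wherever `W(φ)` is small, this is almost at least `I (1/6 - I)` with `I = ∫ G(φ)`. For
large `α` the penalty keeps `I` near its initial value, so this quantity stays away from zero
(`le_intG_mul_of_energy_le`). The outcome is `S² ≤ K (1 + e²) (D e + (1 + M²) e²)`
(`exists_sq_multiplier_le`).

In time, the energy identity and Young's inequality give both `E(t) ≤ exp(M² t) E(0)` and `D ≤ -2E'
+ 4M² E`. Hence `(1 + E²) E D` is at most the exact derivative `-(E² + E⁴/2)'` plus terms controlled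
by the growth bound, and the estimate for `S²` can be integrated
(`intervalIntegrable_and_integral_le`). All of this needs `0 ≤ φ ≤ 1` and `u ≥ 0`, which come from a
minimum principle (`nonneg_of_parabolic_supersolution`). -/

lemma IsPeriodic.add_of_mem_span {n : ℕ} {f : Space n → ℝ} (hf : IsPeriodic f) {v : Space n}
    (hv : v ∈ Submodule.span ℤ (range (EuclideanSpace.basisFun (Fin n) ℝ).toBasis)) (x : Space n) :
    f (x + v) = f x := by
  have key : ∀ w : Space n, (∀ x, f (x + w) = f x) → ∀ (m : ℤ) x, f (x + m • w) = f x := by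
    intro w hw m
    have hn : ∀ x, f (x - w) = f x := fun x => by rw [← hw (x - w), sub_add_cancel]
    induction m with
    | zero => simp
    | succ k ih =>
      intro x
      rw [add_smul, one_smul, ← add_assoc, hw, ih]
    | pred k ih =>
      intro x
      rw [sub_smul, one_smul, ← add_sub_assoc, hn, ih]
  induction hv using Submodule.span_induction generalizing x with
  | mem w hw =>
    obtain ⟨i, rfl⟩ := hw
    simpa using hf i x
  | zero => simp
  | add v w _ _ h1 h2 => rw [← add_assoc, h2, h1]
  | smul m w _ h => exact key w h m x

lemma cell_eq_fundamentalDomain (n : ℕ) :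
    cell n = ZSpan.fundamentalDomain (EuclideanSpace.basisFun (Fin n) ℝ).toBasis := by
  ext x
  simp [cell, ZSpan.mem_fundamentalDomain]

/-- One representative serves all periodic functions at once. This moves bounds and minima found on
the compact cube to the whole space. -/
lemma exists_mem_cell {n : ℕ} (x : Space n) :
    ∃ y ∈ cell n, ∀ f : Space n → ℝ, IsPeriodic f → f y = f x := by
  refine ⟨ZSpan.fract (EuclideanSpace.basisFun (Fin n) ℝ).toBasis x, ?_, fun f hf => ?_⟩
  · rw [cell_eq_fundamentalDomain]
    exact ZSpan.fract_mem_fundamentalDomain _ x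
  · rw [ZSpan.fract_apply, sub_eq_add_neg]
    exact hf.add_of_mem_span (neg_mem (ZSpan.floor _ x).2) x

lemma measurableSet_cell (n : ℕ) : MeasurableSet (cell n) := by
  rw [cell_eq_fundamentalDomain]
  exact ZSpan.fundamentalDomain_measurableSet _

lemma volume_cell (n : ℕ) : volume (cell n) = 1 := by
  have h : cell n = (MeasurableEquiv.toLp 2 (Fin n → ℝ)).symm ⁻¹'
      (univ.pi fun _ => Ico (0 : ℝ) 1) := by
    ext x
    simp [cell]
  rw [h, (EuclideanSpace.volume_preserving_symm_measurableEquiv_toLp (Fin n)).measure_preimage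
    (MeasurableSet.univ_pi fun _ => measurableSet_Ico).nullMeasurableSet, volume_pi_pi]
  simp

lemma cellVolume_eq_one (n : ℕ) : cellVolume n = 1 := by
  simp [cellVolume, Measure.real, volume_cell]

instance isProbabilityMeasure_restrict_cell (n : ℕ) :
    IsProbabilityMeasure (volume.restrict (cell n)) :=
  ⟨by simp [volume_cell]⟩

open scoped Pointwise in
-- The cell and its translate by `v` are both fundamental domains of the integer lattice, and a
-- lattice-invariant function has the same integral over either.
lemma setIntegral_cell_add {n : ℕ} {f : Space n → ℝ} (hf : IsPeriodic f) (v : Space n) :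
    ∫ x in cell n, f (x + v) = ∫ x in cell n, f x := by
  set b : Module.Basis (Fin n) ℝ (Space n) := (EuclideanSpace.basisFun (Fin n) ℝ).toBasis with hb
  have h1 := ZSpan.isAddFundamentalDomain' b (volume : Measure (Space n))
  have h2 : IsAddFundamentalDomain (Submodule.span ℤ (range b)).toAddSubgroup
      (v +ᵥ ZSpan.fundamentalDomain b) (volume : Measure (Space n)) := by
    refine ⟨?_, ?_, ?_⟩
    · exact ((ZSpan.fundamentalDomain_measurableSet b).const_vadd v).nullMeasurableSet
    · refine Filter.Eventually.of_forall fun x => ?_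
      obtain ⟨g, hg, -⟩ := ZSpan.exist_unique_vadd_mem_fundamentalDomain b (x - v)
      refine ⟨⟨g.1, g.2⟩, ?_⟩
      rw [mem_vadd_set_iff_neg_vadd_mem]
      convert hg using 1
      simp only [Submodule.vadd_def, AddSubgroup.vadd_def, vadd_eq_add]
      abel
    · intro g g' hgg
      have := h1.aedisjoint hgg
      have e : ∀ k : (Submodule.span ℤ (range b)).toAddSubgroup,
          k +ᵥ (v +ᵥ ZSpan.fundamentalDomain b) = v +ᵥ (k +ᵥ ZSpan.fundamentalDomain b) := by
        intro k
        ext x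
        simp only [mem_vadd_set_iff_neg_vadd_mem, AddSubgroup.vadd_def, vadd_eq_add]
        rw [add_left_comm]
      simp only [Function.onFun, AEDisjoint] at this ⊢
      rw [e, e, ← vadd_set_inter, measure_vadd]
      exact this
  have hinv : ∀ (g : (Submodule.span ℤ (range b)).toAddSubgroup) (x : Space n),
      f (g +ᵥ x) = f x := by
    intro g x
    rw [AddSubgroup.vadd_def, vadd_eq_add, add_comm]
    exact hf.add_of_mem_span g.2 x
  have : Countable (Submodule.span ℤ (range b)).toAddSubgroup :=
    inferInstanceAs (Countable (Submodule.span ℤ (range b)))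
  rw [cell_eq_fundamentalDomain, h1.setIntegral_eq h2 hinv]
  have hpre : (fun x : Space n => x + v) ⁻¹' (v +ᵥ ZSpan.fundamentalDomain b)
      = ZSpan.fundamentalDomain b := by
    ext x
    simp [mem_vadd_set_iff_neg_vadd_mem]
  have := (measurePreserving_add_right (volume : Measure (Space n)) v).setIntegral_preimage_emb
    (MeasurableEquiv.addRight v).measurableEmbedding f (v +ᵥ ZSpan.fundamentalDomain b)
  rw [hpre] at this
  exact this

/-- The closed unit cube. -/
def cube (n : ℕ) : Set (Space n) := {x | ∀ i, x i ∈ Icc (0 : ℝ) 1}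

lemma cell_subset_cube (n : ℕ) : cell n ⊆ cube n := fun _ hx i => Ico_subset_Icc_self (hx i)

lemma isCompact_cube (n : ℕ) : IsCompact (cube n) := by
  have h : cube n = (EuclideanSpace.equiv (Fin n) ℝ).toHomeomorph.symm ''
      (univ.pi fun _ => Icc (0 : ℝ) 1) := by
    ext x
    rw [Homeomorph.image_symm]
    simp [cube, Pi.le_def, forall_and]
  rw [h]
  exact (isCompact_univ_pi fun _ => isCompact_Icc).image (Homeomorph.continuous _)

lemma _root_.Continuous.integrableOn_cell {n : ℕ} {f : Space n → ℝ} (hf : Continuous f) :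
    IntegrableOn f (cell n) :=
  (hf.continuousOn.integrableOn_compact (isCompact_cube n)).mono_set (cell_subset_cube n)

lemma IsPeriodic.exists_bound {n : ℕ} {f : Space n → ℝ} (hf : IsPeriodic f) (hc : Continuous f) :
    ∃ B, ∀ x, |f x| ≤ B := by
  obtain ⟨B, hB⟩ := (isCompact_cube n).exists_bound_of_continuousOn hc.continuousOn
  refine ⟨B, fun x => ?_⟩
  obtain ⟨y, hy, h⟩ := exists_mem_cell x
  rw [← h f hf]
  exact hB y (cell_subset_cube n hy)

/-- A function that is continuous on `S × ℝⁿ` is bounded on `K × [0,1]ⁿ`, `K ⊆ S` compact. -/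
lemma exists_bound_cube {n : ℕ} {S K : Set ℝ} {F : ℝ × Space n → ℝ}
    (hF : ContinuousOn F (S ×ˢ univ)) (hK : IsCompact K) (hKS : K ⊆ S) :
    ∃ B, ∀ t ∈ K, ∀ x ∈ cube n, |F (t, x)| ≤ B := by
  obtain ⟨B, hB⟩ := (hK.prod (isCompact_cube n)).exists_bound_of_continuousOn
    (hF.mono (prod_mono hKS (subset_univ _)))
  exact ⟨B, fun t ht x hx => hB (t, x) ⟨ht, hx⟩⟩

lemma continuous_of_continuousOn_prod {n : ℕ} {S : Set ℝ} {F : ℝ × Space n → ℝ}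
    (hF : ContinuousOn F (S ×ˢ univ)) {t : ℝ} (ht : t ∈ S) : Continuous fun x => F (t, x) := by
  rw [← continuousOn_univ]
  exact hF.comp (by fun_prop) fun x _ => ⟨ht, mem_univ x⟩

/-! ### Calculus of integrals over the cell. -/

lemma integral_cell_mono {n : ℕ} {f g : Space n → ℝ} (hf : Continuous f) (hg : Continuous g)
    (h : ∀ x, f x ≤ g x) : ∫ x in cell n, f x ≤ ∫ x in cell n, g x :=
  setIntegral_mono hf.integrableOn_cell hg.integrableOn_cell h

lemma integral_cell_nonneg {n : ℕ} {f : Space n → ℝ} (h : ∀ x, 0 ≤ f x) :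
    0 ≤ ∫ x in cell n, f x :=
  integral_nonneg h

lemma abs_integral_cell_le {n : ℕ} {f g : Space n → ℝ} (hg : Continuous g)
    (h : ∀ x, |f x| ≤ g x) : |∫ x in cell n, f x| ≤ ∫ x in cell n, g x :=
  (Real.norm_eq_abs _).symm.trans_le
    (norm_integral_le_of_norm_le hg.integrableOn_cell (Filter.Eventually.of_forall h))

lemma integral_cell_add {n : ℕ} {f g : Space n → ℝ} (hf : Continuous f) (hg : Continuous g) :
    ∫ x in cell n, (f x + g x) = (∫ x in cell n, f x) + ∫ x in cell n, g x :=
  integral_add hf.integrableOn_cell hg.integrableOn_cell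

lemma integral_cell_sub {n : ℕ} {f g : Space n → ℝ} (hf : Continuous f) (hg : Continuous g) :
    ∫ x in cell n, (f x - g x) = (∫ x in cell n, f x) - ∫ x in cell n, g x :=
  integral_sub hf.integrableOn_cell hg.integrableOn_cell

lemma integral_cell_sum {n : ℕ} {ι : Type*} (s : Finset ι) {f : ι → Space n → ℝ}
    (hf : ∀ i ∈ s, Continuous (f i)) :
    ∫ x in cell n, ∑ i ∈ s, f i x = ∑ i ∈ s, ∫ x in cell n, f i x :=
  integral_finsetSum s fun i hi => (hf i hi).integrableOn_cell

lemma integral_cell_const {n : ℕ} (c : ℝ) : ∫ _ in cell n, c = c := by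
  simp

/-- Continuity in time of an integral over the cell. -/
lemma continuousOn_integral_cell {n : ℕ} {S : Set ℝ} {F : ℝ × Space n → ℝ}
    (hS : ∀ t ∈ S, ∃ K, IsCompact K ∧ K ⊆ S ∧ K ∈ nhdsWithin t S)
    (hF : ContinuousOn F (S ×ˢ univ)) : ContinuousOn (fun t => ∫ x in cell n, F (t, x)) S := by
  intro t ht
  obtain ⟨K, hK, hKS, hKt⟩ := hS t ht
  obtain ⟨B, hB⟩ := exists_bound_cube hF hK hKS
  refine continuousWithinAt_of_dominated (bound := fun _ => B) ?_ ?_ (by simp) ?_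
  · filter_upwards [self_mem_nhdsWithin] with s hs
    exact (continuous_of_continuousOn_prod hF hs).aestronglyMeasurable
  · filter_upwards [hKt] with s hs
    filter_upwards [ae_restrict_mem (measurableSet_cell n)] with x hx
    exact hB s hs x (cell_subset_cube n hx)
  · refine Filter.Eventually.of_forall fun x => ?_
    exact (hF (t, x) ⟨ht, mem_univ x⟩).comp (f := fun s => (s, x)) (by fun_prop)
      fun s hs => ⟨hs, mem_univ x⟩

/-! ### Partial derivatives -/

/-- The `i`-th partial derivative. -/
def pd {n : ℕ} (i : Fin n) (f : Space n → ℝ) (x : Space n) : ℝ :=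
  fderiv ℝ f x (EuclideanSpace.single i 1)

section
variable {n : ℕ} {f g : Space n → ℝ}

lemma IsPeriodic.fderiv (hf : IsPeriodic f) (i : Fin n) (x : Space n) :
    fderiv ℝ f (x + EuclideanSpace.single i 1) = fderiv ℝ f x := by
  have h : (fun y => f (y + EuclideanSpace.single i 1)) = f := funext fun y => hf i y
  rw [← fderiv_comp_add_right, h]

lemma IsPeriodic.pd (hf : IsPeriodic f) (j : Fin n) : IsPeriodic (pd j f) := fun i x => by
  rw [PhaseField.pd, hf.fderiv, PhaseField.pd]

lemma IsPeriodic.comp (hf : IsPeriodic f) (h : ℝ → ℝ) : IsPeriodic fun x => h (f x) :=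
  fun i x => congrArg h (hf i x)

lemma IsPeriodic.comp₂ (hf : IsPeriodic f) (hg : IsPeriodic g) (h : ℝ → ℝ → ℝ) :
    IsPeriodic fun x => h (f x) (g x) :=
  fun i x => congrArg₂ h (hf i x) (hg i x)

lemma IsPeriodic.mul (hf : IsPeriodic f) (hg : IsPeriodic g) : IsPeriodic fun x => f x * g x :=
  hf.comp₂ hg fun a b => a * b

lemma continuous_pd (hf : ContDiff ℝ 1 f) (i : Fin n) : Continuous (pd i f) :=
  (hf.continuous_fderiv one_ne_zero).clm_apply continuous_const

lemma contDiff_pd (hf : ContDiff ℝ 2 f) (i : Fin n) : ContDiff ℝ 1 (pd i f) :=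
  (hf.fderiv_right (m := 1) (by norm_num)).clm_apply contDiff_const

lemma norm_gradient_sq (f : Space n → ℝ) (x : Space n) :
    ‖gradient f x‖ ^ 2 = ∑ i, pd i f x ^ 2 := by
  have h : ∀ i, gradient f x i = pd i f x := by
    intro i
    have := InnerProductSpace.toDual_symm_apply (𝕜 := ℝ) (x := EuclideanSpace.single i (1 : ℝ))
      (y := fderiv ℝ f x)
    rw [pd, ← this, real_inner_comm, EuclideanSpace.inner_single_left]
    simp [gradient]
  rw [EuclideanSpace.norm_sq_eq]
  simp [h]

lemma abs_pd_le (f : Space n → ℝ) (i : Fin n) (x : Space n) : |pd i f x| ≤ ‖gradient f x‖ := by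
  rw [← sq_le_sq₀ (abs_nonneg _) (norm_nonneg _), norm_gradient_sq, sq_abs]
  exact Finset.single_le_sum (f := fun i => pd i f x ^ 2) (fun j _ => sq_nonneg _)
    (Finset.mem_univ i)

lemma laplacian_eq_sum_iteratedFDeriv (f : Space n → ℝ) (x : Space n) :
    (Laplacian.laplacian f : Space n → ℝ) x = ∑ i, iteratedFDeriv ℝ 2 f x
      ![EuclideanSpace.single i 1, EuclideanSpace.single i 1] := by
  rw [InnerProductSpace.laplacian_eq_iteratedFDeriv_orthonormalBasis f
    (EuclideanSpace.basisFun (Fin n) ℝ)]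
  simp

lemma pd_pd (hf : ContDiff ℝ 2 f) (i j : Fin n) (x : Space n) :
    pd i (pd j f) x = iteratedFDeriv ℝ 2 f x
      ![EuclideanSpace.single i 1, EuclideanSpace.single j 1] := by
  have hd : DifferentiableAt ℝ (fderiv ℝ f) x :=
    ((hf.fderiv_right (m := 1) (by norm_num)).differentiable one_ne_zero) x
  rw [iteratedFDeriv_two_apply]
  have : HasFDerivAt (pd j f)
      ((fderiv ℝ (fderiv ℝ f) x).flip (EuclideanSpace.single j 1)) x :=
    (hd.hasFDerivAt.clm_apply (hasFDerivAt_const (EuclideanSpace.single j (1 : ℝ)) x)).congr_fderiv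
      (by ext; simp)
  rw [pd, this.fderiv]
  simp

lemma laplacian_eq_sum_pd (hf : ContDiff ℝ 2 f) (x : Space n) :
    (Laplacian.laplacian f : Space n → ℝ) x = ∑ i, pd i (pd i f) x := by
  simp [laplacian_eq_sum_iteratedFDeriv, pd_pd hf]

lemma pd_comm (hf : ContDiff ℝ 2 f) (i j : Fin n) (x : Space n) :
    pd i (pd j f) x = pd j (pd i f) x := by
  have hs : IsSymmSndFDerivAt ℝ f x := hf.contDiffAt.isSymmSndFDerivAt (by simp)
  rw [pd_pd hf, pd_pd hf, iteratedFDeriv_two_apply, iteratedFDeriv_two_apply]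
  exact hs.eq _ _

lemma pd_mul {x : Space n} (hf : DifferentiableAt ℝ f x) (hg : DifferentiableAt ℝ g x) (i : Fin n) :
    pd i (fun y => f y * g y) x = f x * pd i g x + pd i f x * g x := by
  rw [pd, fderiv_fun_mul hf hg]
  simp only [pd, add_apply, FunLike.coe_smul, Pi.smul_apply, smul_eq_mul]
  ring

lemma pd_comp {h : ℝ → ℝ} {h' : ℝ} {x : Space n} (hf : DifferentiableAt ℝ f x)
    (hh : HasDerivAt h h' (f x)) (i : Fin n) : pd i (fun y => h (f y)) x = h' * pd i f x := by
  have := hh.comp_hasFDerivAt x hf.hasFDerivAt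
  rw [pd, show (fun y => h (f y)) = h ∘ f from rfl, this.fderiv]
  rfl

lemma hasDerivAt_line (hf : ContDiff ℝ 1 f) (x v : Space n) (s : ℝ) :
    HasDerivAt (fun s : ℝ => f (x + s • v)) (fderiv ℝ f (x + s • v) v) s := by
  have h1 : HasDerivAt (fun s : ℝ => x + s • v) v s := by
    simpa using ((hasDerivAt_id s).smul_const v).const_add x
  exact ((hf.differentiable one_ne_zero) _).hasFDerivAt.comp_hasDerivAt s h1

lemma sub_eq_integral_fderiv (hf : ContDiff ℝ 1 f) (x v : Space n) :
    f (x + v) - f x = ∫ s in (0 : ℝ)..1, fderiv ℝ f (x + s • v) v := by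
  have hc : Continuous fun s : ℝ => fderiv ℝ f (x + s • v) v :=
    ((hf.continuous_fderiv one_ne_zero).comp (by fun_prop)).clm_apply continuous_const
  rw [intervalIntegral.integral_eq_sub_of_hasDerivAt (fun s _ => hasDerivAt_line hf x v s)
    (hc.intervalIntegrable 0 1)]
  simp

/-- Averaging along lines commutes with integration over the cell. -/
lemma integral_cell_integral_line {F : ℝ → Space n → ℝ} (hF : Continuous (Function.uncurry F)) :
    ∫ x in cell n, ∫ s in (0 : ℝ)..1, F s x = ∫ s in (0 : ℝ)..1, ∫ x in cell n, F s x := by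
  simp_rw [intervalIntegral.integral_of_le zero_le_one]
  refine integral_integral_swap ?_
  rw [Measure.prod_restrict]
  have hc : ContinuousOn (Function.uncurry fun x s => F s x) (cube n ×ˢ Icc (0 : ℝ) 1) :=
    (hF.comp continuous_swap).continuousOn
  exact (hc.integrableOn_compact ((isCompact_cube n).prod isCompact_Icc)).mono_set
    (prod_mono (cell_subset_cube n) Ioc_subset_Icc_self)

/-- Averaging `∂ᵢ f` over a unit segment in direction `i` gives `f(x + eᵢ) - f(x) = 0`, while
translation invariance shows that averaging does not change the integral over the cell. -/
lemma integral_pd (hf : ContDiff ℝ 1 f) (hp : IsPeriodic f) (i : Fin n) :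
    ∫ x in cell n, pd i f x = 0 := by
  have hF : Continuous (Function.uncurry fun (s : ℝ) (x : Space n) =>
      pd i f (x + s • EuclideanSpace.single i 1)) :=
    (continuous_pd hf i).comp (by fun_prop)
  have h := integral_cell_integral_line hF
  have h1 : ∀ x, ∫ s in (0 : ℝ)..1, pd i f (x + s • EuclideanSpace.single i 1) = 0 := by
    intro x
    have := sub_eq_integral_fderiv hf x (EuclideanSpace.single i 1)
    rw [hp i x, sub_self] at this
    exact this.symm
  simp_rw [h1, setIntegral_cell_add (hp.pd i)] at h
  simpa using h.symm

lemma integral_pd_mul (hf : ContDiff ℝ 1 f) (hg : ContDiff ℝ 1 g) (hpf : IsPeriodic f)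
    (hpg : IsPeriodic g) (i : Fin n) :
    ∫ x in cell n, pd i f x * g x = -∫ x in cell n, f x * pd i g x := by
  have h := integral_pd (hf.mul hg) (hpf.mul hpg) i
  have h1 : ∀ x, pd i (fun y => f y * g y) x = f x * pd i g x + pd i f x * g x := fun x =>
    pd_mul (hf.differentiable one_ne_zero x) (hg.differentiable one_ne_zero x) i
  simp_rw [h1] at h
  rw [integral_cell_add (f := fun x => f x * pd i g x) (g := fun x => pd i f x * g x)
    (hf.continuous.mul (continuous_pd hg i)) ((continuous_pd hf i).mul hg.continuous)] at h
  linarith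

/-! ### Averages along segments -/

/-- The average of `f` along the segment from `x` to `x + v` with weight `w`. -/
def lineAvg (w : ℝ → ℝ) (v : Space n) (f : Space n → ℝ) (x : Space n) : ℝ :=
  ∫ s in (0 : ℝ)..1, w s * f (x + s • v)

variable {w : ℝ → ℝ} {v : Space n}

lemma IsPeriodic.lineAvg (hp : IsPeriodic f) : IsPeriodic (lineAvg w v f) := by
  intro i x
  have : ∀ s : ℝ, f (x + EuclideanSpace.single i 1 + s • v) = f (x + s • v) := fun s => by
    rw [add_right_comm, hp i]
  simp [PhaseField.lineAvg, this]

lemma continuous_lineAvg (hw : Continuous w) (hf : Continuous f) : Continuous (lineAvg w v f) := by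
  apply intervalIntegral.continuous_parametric_intervalIntegral_of_continuous'
  simp only [Function.uncurry_def]
  fun_prop

lemma hasFDerivAt_lineAvg (hw : Continuous w) (hf : ContDiff ℝ 1 f) (hp : IsPeriodic f)
    (x : Space n) :
    HasFDerivAt (lineAvg w v f) (∫ s in (0 : ℝ)..1, w s • fderiv ℝ f (x + s • v)) x := by
  have hc := hf.continuous_fderiv one_ne_zero
  have hcf := hf.continuous
  obtain ⟨B, hB⟩ := IsPeriodic.exists_bound (f := fun x => ‖fderiv ℝ f x‖)
    (fun i x => congrArg norm (hp.fderiv i x)) hc.norm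
  refine intervalIntegral.hasFDerivAt_integral_of_dominated_of_fderiv_le
    (bound := fun s => |w s| * B) Filter.univ_mem
    (F' := fun x s => w s • fderiv ℝ f (x + s • v)) ?_ ?_ ?_ ?_ ?_ ?_
  · refine Filter.Eventually.of_forall fun y => Continuous.aestronglyMeasurable ?_
    fun_prop
  · apply Continuous.intervalIntegrable
    fun_prop
  · refine Continuous.aestronglyMeasurable ?_
    fun_prop
  · refine Filter.Eventually.of_forall fun s _ y _ => ?_
    rw [norm_smul, Real.norm_eq_abs]
    exact mul_le_mul_of_nonneg_left ((le_abs_self _).trans (hB _)) (abs_nonneg _)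
  · apply Continuous.intervalIntegrable
    fun_prop
  · refine Filter.Eventually.of_forall fun s _ y _ => ?_
    have h1 : HasFDerivAt (fun y : Space n => f (y + s • v)) (fderiv ℝ f (y + s • v)) y := by
      rw [hasFDerivAt_comp_add_right]
      exact (hf.differentiable one_ne_zero _).hasFDerivAt
    exact h1.const_mul (w s)

lemma contDiff_lineAvg (hw : Continuous w) (hf : ContDiff ℝ 1 f) (hp : IsPeriodic f) :
    ContDiff ℝ 1 (lineAvg w v f) := by
  rw [contDiff_one_iff_hasFDerivAt]
  refine ⟨_, ?_, hasFDerivAt_lineAvg hw hf hp⟩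
  have hc := hf.continuous_fderiv one_ne_zero
  apply intervalIntegral.continuous_parametric_intervalIntegral_of_continuous'
  simp only [Function.uncurry_def]
  fun_prop

lemma pd_lineAvg (hw : Continuous w) (hf : ContDiff ℝ 1 f) (hp : IsPeriodic f) (i : Fin n) :
    pd i (lineAvg w v f) = lineAvg w v (pd i f) := by
  have hc := hf.continuous_fderiv one_ne_zero
  ext x
  have hi : IntervalIntegrable (fun s : ℝ => w s • fderiv ℝ f (x + s • v)) volume 0 1 := by
    apply Continuous.intervalIntegrable
    fun_prop
  rw [pd, (hasFDerivAt_lineAvg hw hf hp x).fderiv,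
    ContinuousLinearMap.intervalIntegral_apply hi]
  rfl

lemma abs_lineAvg_le (hw : ∀ s ∈ Icc (0 : ℝ) 1, |w s| ≤ 1) {B : ℝ} (hB : ∀ x, |f x| ≤ B)
    (x : Space n) : |lineAvg w v f x| ≤ B := by
  have h := intervalIntegral.norm_integral_le_of_norm_le_const (a := (0 : ℝ)) (b := 1) (C := B)
    (f := fun s => w s * f (x + s • v)) fun s hs => by
      rw [uIoc_of_le zero_le_one] at hs
      rw [Real.norm_eq_abs, abs_mul]
      calc |w s| * |f (x + s • v)| ≤ 1 * B :=
            mul_le_mul (hw s (Ioc_subset_Icc_self hs)) (hB _) (abs_nonneg _) zero_le_one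
        _ = B := one_mul B
  simpa [lineAvg] using h

lemma integral_lineAvg (hf : Continuous f) (hp : IsPeriodic f) :
    ∫ x in cell n, lineAvg (fun _ => 1) v f x = ∫ x in cell n, f x := by
  have := integral_cell_integral_line (F := fun s x => f (x + s • v)) (by fun_prop)
  simp_rw [setIntegral_cell_add hp] at this
  simpa [lineAvg] using this

lemma abs_lineAvg_one_le (f : Space n → ℝ) (x : Space n) :
    |lineAvg (fun _ => 1) v f x| ≤ lineAvg (fun _ => 1) v (fun x => |f x|) x := by
  simp only [lineAvg, one_mul]
  exact intervalIntegral.abs_integral_le_integral_abs zero_le_one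

lemma integral_abs_lineAvg_le (hf : Continuous f) (hp : IsPeriodic f) :
    ∫ x in cell n, |lineAvg (fun _ => 1) v f x| ≤ ∫ x in cell n, |f x| := by
  rw [← integral_lineAvg (v := v) hf.abs (hp.comp fun a => |a|)]
  exact integral_cell_mono (continuous_lineAvg continuous_const hf).abs
    (continuous_lineAvg continuous_const hf.abs) (abs_lineAvg_one_le f)

/-- The derivative of an average in its own direction. -/
lemma lineAvg_one_fderiv (hf : ContDiff ℝ 1 f) (x v : Space n) :
    lineAvg (fun _ => 1) v (fun y => fderiv ℝ f y v) x = f (x + v) - f x := by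
  simp [lineAvg, sub_eq_integral_fderiv hf]

/-- Integration by parts along the segment: the weight `s - 1/2` has slope one and end values
`∓1/2`. If `v` is a period of `f`, the right side is `f` minus its average over that period, so this
weight inverts `∂_v` on functions of zero mean along `v`. -/
lemma lineAvg_sub_half_fderiv (hf : ContDiff ℝ 1 f) (x v : Space n) :
    lineAvg (fun s => s - 1 / 2) v (fun y => fderiv ℝ f y v) x
      = (f (x + v) + f x) / 2 - lineAvg (fun _ => 1) v f x := by
  have hc : Continuous fun s : ℝ => fderiv ℝ f (x + s • v) v :=
    ((hf.continuous_fderiv one_ne_zero).comp (by fun_prop)).clm_apply continuous_const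
  have h := intervalIntegral.integral_mul_deriv_eq_deriv_mul (a := 0) (b := 1)
    (u := fun s : ℝ => s - 1 / 2) (u' := fun _ => 1)
    (fun s _ => by simpa using (hasDerivAt_id s).sub_const (1 / 2 : ℝ))
    (fun s _ => hasDerivAt_line hf x v s) (by simp) (hc.intervalIntegrable 0 1)
  rw [lineAvg, h, lineAvg]
  simp only [one_smul, zero_smul, add_zero]
  ring

/-- `‖f(· + sv) - f‖` averaged over `s` is controlled by the derivative in direction `v`. -/
lemma integral_abs_lineAvg_sub_le (hf : ContDiff ℝ 1 f) (v : Space n)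
    (hpv : IsPeriodic fun x => fderiv ℝ f x v) :
    ∫ x in cell n, |lineAvg (fun _ => 1) v f x - f x| ≤ ∫ x in cell n, |fderiv ℝ f x v| := by
  have hc : Continuous fun x => fderiv ℝ f x v :=
    (hf.continuous_fderiv one_ne_zero).clm_apply continuous_const
  have hcf := hf.continuous
  have key : ∀ x, |lineAvg (fun _ => 1) v f x - f x| ≤
      lineAvg (fun _ => 1) v (fun x => |fderiv ℝ f x v|) x := by
    intro x
    have h0 : lineAvg (fun _ => 1) v f x - f x
        = ∫ s in (0 : ℝ)..1, (f (x + s • v) - f x) := by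
      have hi : IntervalIntegrable (fun s : ℝ => f (x + s • v)) volume 0 1 := by
        apply Continuous.intervalIntegrable
        fun_prop
      rw [intervalIntegral.integral_sub hi (by simp)]
      simp [lineAvg]
    have h1 : ∀ s ∈ Icc (0 : ℝ) 1, |f (x + s • v) - f x| ≤
        lineAvg (fun _ => 1) v (fun x => |fderiv ℝ f x v|) x := by
      intro s hs
      have hcl : Continuous fun s : ℝ => fderiv ℝ f (x + s • v) v := by fun_prop
      have h2 : f (x + s • v) - f x = ∫ r in (0 : ℝ)..s, fderiv ℝ f (x + r • v) v := by
        rw [intervalIntegral.integral_eq_sub_of_hasDerivAt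
          (fun r _ => hasDerivAt_line hf x v r) (hcl.intervalIntegrable 0 s)]
        simp
      rw [h2]
      refine (intervalIntegral.abs_integral_le_integral_abs hs.1).trans ?_
      simp only [lineAvg, one_mul]
      exact intervalIntegral.integral_mono_interval le_rfl hs.1 hs.2
        (Filter.Eventually.of_forall fun _ => abs_nonneg _)
        (hcl.abs.intervalIntegrable 0 1)
    rw [h0]
    have h3 := intervalIntegral.norm_integral_le_of_norm_le_const (a := (0 : ℝ)) (b := 1)
      (C := lineAvg (fun _ => 1) v (fun x => |fderiv ℝ f x v|) x)
      (f := fun s : ℝ => f (x + s • v) - f x) fun s hs => by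
        rw [uIoc_of_le zero_le_one] at hs
        exact h1 s (Ioc_subset_Icc_self hs)
    simpa using h3
  refine (integral_cell_mono ?_ (continuous_lineAvg continuous_const hc.abs) key).trans_eq
    (integral_lineAvg hc.abs (hpv.comp fun a => |a|))
  exact ((continuous_lineAvg continuous_const hcf).sub hcf).abs

end

/-! ### Mollification and a vector field with prescribed divergence -/

/-- Average over a segment of length `δ` in each coordinate direction in turn. The derivative in the
direction just averaged is a difference quotient over length `δ`, hence at most `2B/δ`. The `L¹`
error of each average is `δ` times the `L¹` norm of the corresponding partial derivative. -/
lemma exists_mollification {n : ℕ} {g : Space n → ℝ} (hg : ContDiff ℝ 1 g) (hp : IsPeriodic g)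
    {B : ℝ} (hB : ∀ x, |g x| ≤ B) {δ : ℝ} (hδ : 0 < δ) :
    ∃ f : Space n → ℝ, ContDiff ℝ 1 f ∧ IsPeriodic f ∧ (∀ x, |f x| ≤ B) ∧
      (∀ i x, |pd i f x| ≤ 2 * B / δ) ∧ ∫ x in cell n, f x = ∫ x in cell n, g x ∧
      ∫ x in cell n, |f x - g x| ≤ δ * ∑ i, ∫ x in cell n, |pd i g x| := by
  -- The induction also carries the `L¹` bounds on the partial derivatives: the next averaging error
  -- involves `∂ₐ f` for the current `f`, not `∂ₐ g`.
  suffices H : ∀ s : Finset (Fin n), ∃ f : Space n → ℝ, ContDiff ℝ 1 f ∧ IsPeriodic f ∧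
      (∀ x, |f x| ≤ B) ∧ (∀ i ∈ s, ∀ x, |pd i f x| ≤ 2 * B / δ) ∧
      (∀ i, ∫ x in cell n, |pd i f x| ≤ ∫ x in cell n, |pd i g x|) ∧
      ∫ x in cell n, f x = ∫ x in cell n, g x ∧
      ∫ x in cell n, |f x - g x| ≤ δ * ∑ i ∈ s, ∫ x in cell n, |pd i g x| by
    obtain ⟨f, h1, h2, h3, h4, -, h6, h7⟩ := H Finset.univ
    exact ⟨f, h1, h2, h3, fun i => h4 i (Finset.mem_univ i), h6, h7⟩
  intro s
  induction s using Finset.induction_on with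
  | empty => exact ⟨g, hg, hp, hB, by simp, fun i => le_rfl, rfl, by simp⟩
  | insert a s ha ih =>
    obtain ⟨f, hf, hpf, hfB, hfs, hfi, hfint, hfg⟩ := ih
    set v : Space n := δ • EuclideanSpace.single a 1 with hv
    have hw : Continuous fun _ : ℝ => (1 : ℝ) := continuous_const
    have hw1 : ∀ s ∈ Icc (0 : ℝ) 1, |(fun _ : ℝ => (1 : ℝ)) s| ≤ 1 := by simp
    have hpd : ∀ i, pd i (lineAvg (fun _ => 1) v f) = lineAvg (fun _ => 1) v (pd i f) :=
      pd_lineAvg hw hf hpf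
    have hfd : (fun y => fderiv ℝ f y v) = fun y => δ * pd a f y := by
      ext y
      simp [hv, pd]
    refine ⟨lineAvg (fun _ => 1) v f, contDiff_lineAvg hw hf hpf, hpf.lineAvg,
      abs_lineAvg_le hw1 hfB, ?_, ?_, ?_, ?_⟩
    · intro i hi x
      rcases Finset.mem_insert.1 hi with rfl | hi
      · have h1 := lineAvg_one_fderiv hf x v
        rw [hfd] at h1
        have h2 : δ * pd i (lineAvg (fun _ => 1) v f) x = f (x + v) - f x := by
          rw [hpd, ← h1]
          simp [lineAvg]
        have h3 : |pd i (lineAvg (fun _ => 1) v f) x| * δ = |f (x + v) - f x| := by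
          rw [← h2, abs_mul, abs_of_pos hδ, mul_comm]
        rw [le_div_iff₀ hδ, h3]
        have := abs_sub (f (x + v)) (f x)
        linarith [hfB (x + v), hfB x]
      · rw [hpd]
        exact abs_lineAvg_le hw1 (hfs i hi) x
    · intro i
      rw [hpd]
      exact (integral_abs_lineAvg_le (continuous_pd hf i) (hpf.pd i)).trans (hfi i)
    · rw [integral_lineAvg hf.continuous hpf, hfint]
    · have hc := continuous_lineAvg (v := v) hw hf.continuous
      have hcf := hf.continuous
      have hcg := hg.continuous
      have h1 : ∫ x in cell n, |lineAvg (fun _ => 1) v f x - f x| ≤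
          δ * ∫ x in cell n, |pd a f x| := by
        refine (integral_abs_lineAvg_sub_le hf v ?_).trans_eq ?_
        · rw [hfd]
          exact (hpf.pd a).comp fun y => δ * y
        · rw [← integral_const_mul]
          refine integral_congr_ae (Filter.Eventually.of_forall fun x => ?_)
          have := congrFun hfd x
          simp only at this ⊢
          rw [this, abs_mul, abs_of_pos hδ]
      rw [Finset.sum_insert ha, mul_add]
      calc ∫ x in cell n, |lineAvg (fun _ => 1) v f x - g x|
          ≤ ∫ x in cell n, (|lineAvg (fun _ => 1) v f x - f x| + |f x - g x|) :=
            integral_cell_mono (by fun_prop) (by fun_prop) fun x => abs_sub_le _ _ _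
        _ = (∫ x in cell n, |lineAvg (fun _ => 1) v f x - f x|) + ∫ x in cell n, |f x - g x| :=
            integral_cell_add (by fun_prop) (by fun_prop)
        _ ≤ _ := add_le_add (h1.trans (mul_le_mul_of_nonneg_left (hfi a) hδ.le)) hfg

/-- The divergence equation is solved one coordinate at a time by the antiderivative of
`lineAvg_sub_half_fderiv`. Every operation is an average with weight at most one in absolute value,
so the bounds on `f` and on its partial derivatives pass to `θ` without loss and without elliptic
theory. -/
lemma exists_vectorField {n : ℕ} {f : Space n → ℝ} (hf : ContDiff ℝ 1 f) (hp : IsPeriodic f)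
    {B B' : ℝ} (hB : ∀ x, |f x| ≤ B) (hB' : ∀ i x, |pd i f x| ≤ B') :
    ∃ θ : Fin n → Space n → ℝ, (∀ i, ContDiff ℝ 1 (θ i)) ∧ (∀ i, IsPeriodic (θ i)) ∧
      (∀ i x, |θ i x| ≤ B) ∧ (∀ i j x, |pd j (θ i) x| ≤ B') ∧
      ∀ x, ∑ i, pd i (θ i) x = f x - ∫ y in cell n, f y := by
  -- Here `h` is `f` averaged over full periods in the directions of `s`. It no longer depends on
  -- these coordinates, and the contributions `∂ᵢ θᵢ` telescope to `f - h`. For `s` the full set,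
  -- `h` is the constant `∫ f`.
  suffices H : ∀ s : Finset (Fin n), ∃ (h : Space n → ℝ) (θ : Fin n → Space n → ℝ),
      ContDiff ℝ 1 h ∧ IsPeriodic h ∧ (∀ x, |h x| ≤ B) ∧ (∀ i x, |pd i h x| ≤ B') ∧
      (∀ i ∈ s, ∀ x, pd i h x = 0) ∧ ∫ y in cell n, h y = ∫ y in cell n, f y ∧
      (∀ i, ContDiff ℝ 1 (θ i)) ∧ (∀ i, IsPeriodic (θ i)) ∧
      (∀ i x, |θ i x| ≤ B) ∧ (∀ i j x, |pd j (θ i) x| ≤ B') ∧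
      ∀ x, ∑ i ∈ s, pd i (θ i) x = f x - h x by
    obtain ⟨h, θ, h1, -, -, -, h5, h6, h7, h8, h9, h10, h11⟩ := H Finset.univ
    refine ⟨θ, h7, h8, h9, h10, fun x => ?_⟩
    have hconst : ∀ y, h y = h x := fun y => by
      refine is_const_of_fderiv_eq_zero (h1.differentiable one_ne_zero) (fun z => ?_) y x
      refine ContinuousLinearMap.coe_injective
        ((EuclideanSpace.basisFun (Fin n) ℝ).toBasis.ext fun i => ?_)
      simpa [pd] using h5 i (Finset.mem_univ i) z
    rw [h11, ← h6, integral_congr_ae (Filter.Eventually.of_forall hconst), integral_cell_const]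
  intro s
  induction s using Finset.induction_on with
  | empty =>
    have hB0 : 0 ≤ B := (abs_nonneg _).trans (hB 0)
    refine ⟨f, fun _ _ => 0, hf, hp, hB, hB', by simp, rfl, fun _ => contDiff_const,
      fun _ _ _ => rfl, by simp [hB0], fun i j x => ?_, by simp⟩
    have : 0 ≤ B' := (abs_nonneg _).trans (hB' j 0)
    simpa [pd] using this
  | insert a s ha ih =>
    obtain ⟨h, θ, h1, h2, h3, h4, h5, h6, h7, h8, h9, h10, h11⟩ := ih
    set v : Space n := EuclideanSpace.single a 1 with hv
    have hw : Continuous fun _ : ℝ => (1 : ℝ) := continuous_const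
    have hw1 : ∀ s ∈ Icc (0 : ℝ) 1, |(fun _ : ℝ => (1 : ℝ)) s| ≤ 1 := by simp
    have hw' : Continuous fun s : ℝ => s - 1 / 2 := by fun_prop
    have hw1' : ∀ s ∈ Icc (0 : ℝ) 1, |(fun s : ℝ => s - 1 / 2) s| ≤ 1 := fun s hs => by
      rw [abs_le]
      constructor <;> linarith [hs.1, hs.2]
    have hpd : ∀ i, pd i (lineAvg (fun _ => 1) v h) = lineAvg (fun _ => 1) v (pd i h) :=
      pd_lineAvg hw h1 h2
    have hpd' : ∀ i, pd i (lineAvg (fun s => s - 1 / 2) v h)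
        = lineAvg (fun s => s - 1 / 2) v (pd i h) :=
      pd_lineAvg hw' h1 h2
    refine ⟨lineAvg (fun _ => 1) v h, Function.update θ a (lineAvg (fun s => s - 1 / 2) v h),
      contDiff_lineAvg hw h1 h2, h2.lineAvg, abs_lineAvg_le hw1 h3, ?_, ?_, ?_, ?_, ?_, ?_, ?_, ?_⟩
    · intro i x
      rw [hpd]
      exact abs_lineAvg_le hw1 (h4 i) x
    · intro i hi x
      rw [hpd]
      rcases Finset.mem_insert.1 hi with rfl | hi
      · have := lineAvg_one_fderiv h1 x v
        rwa [h2 i x, sub_self] at this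
      · simp [lineAvg, h5 i hi]
    · rw [integral_lineAvg h1.continuous h2, h6]
    · intro i
      rcases eq_or_ne i a with rfl | hi
      · simpa using contDiff_lineAvg hw' h1 h2
      · simpa [hi] using h7 i
    · intro i
      rcases eq_or_ne i a with rfl | hi
      · simpa using h2.lineAvg
      · simpa [hi] using h8 i
    · intro i
      rcases eq_or_ne i a with rfl | hi
      · rw [Function.update_self]
        exact abs_lineAvg_le hw1' h3
      · simpa [hi] using h9 i
    · intro i j
      rcases eq_or_ne i a with rfl | hi
      · rw [Function.update_self, hpd']
        exact abs_lineAvg_le hw1' (h4 j)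
      · simpa [hi] using h10 i j
    · intro x
      rw [Finset.sum_insert ha, Function.update_self, hpd']
      have e1 : ∑ i ∈ s, pd i (Function.update θ a (lineAvg (fun s => s - 1 / 2) v h) i) x
          = ∑ i ∈ s, pd i (θ i) x :=
        Finset.sum_congr rfl fun i hi => by
          rw [Function.update_of_ne (ne_of_mem_of_not_mem hi ha)]
      have e2 := lineAvg_sub_half_fderiv h1 x v
      rw [h2 a x] at e2
      rw [e1, h11, show pd a h = fun y => fderiv ℝ h y v from rfl, e2]
      ring

/-! ### The potentials -/

lemma hasDerivAt_G (s : ℝ) : HasDerivAt G (s * (1 - s)) s := by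
  have h := ((hasDerivAt_pow 2 s).div_const 2).sub ((hasDerivAt_pow 3 s).div_const 3)
  refine (h.congr_deriv ?_).congr_of_eventuallyEq (Filter.Eventually.of_forall fun x => rfl)
  norm_num
  ring

lemma hasDerivAt_W (s : ℝ) : HasDerivAt W (s * (1 - s) * (1 - 2 * s)) s := by
  have h := ((hasDerivAt_pow 2 s).mul ((((hasDerivAt_id s).const_sub 1).pow 2))).div_const 2
  refine (h.congr_deriv ?_).congr_of_eventuallyEq (Filter.Eventually.of_forall fun x => rfl)
  norm_num
  ring

lemma deriv_G (s : ℝ) : deriv G s = s * (1 - s) := (hasDerivAt_G s).deriv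

lemma deriv_W (s : ℝ) : deriv W s = s * (1 - s) * (1 - 2 * s) := (hasDerivAt_W s).deriv

lemma contDiff_G {m : WithTop ℕ∞} : ContDiff ℝ m G := by
  unfold G
  fun_prop

lemma contDiff_W {m : WithTop ℕ∞} : ContDiff ℝ m W := by
  unfold W
  fun_prop

lemma W_nonneg (s : ℝ) : 0 ≤ W s := by
  unfold W
  positivity

lemma G_nonneg {s : ℝ} (hs : s ≤ 1) : 0 ≤ G s := by
  have : G s = s ^ 2 * (3 - 2 * s) / 6 := by
    unfold G
    ring
  rw [this]
  have : 0 ≤ 3 - 2 * s := by linarith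
  positivity

lemma G_le {s : ℝ} (hs : 0 ≤ s) : G s ≤ 1 / 6 := by
  have : 1 / 6 - G s = (1 - s) ^ 2 * (1 + 2 * s) / 6 := by
    unfold G
    ring
  have h : 0 ≤ (1 - s) ^ 2 * (1 + 2 * s) / 6 := by positivity
  linarith

lemma abs_G_le {s : ℝ} (h0 : 0 ≤ s) (h1 : s ≤ 1) : |G s| ≤ 1 / 6 := by
  rw [abs_of_nonneg (G_nonneg h1)]
  exact G_le h0

/-- `G` is close to `{0, 1/6}` where `W` is small. -/
lemma G_sub_W_le_G_sq {s : ℝ} : G s / 6 - 2 / 9 * W s ≤ G s ^ 2 := by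
  have : G s ^ 2 - (G s / 6 - 2 / 9 * W s) = s ^ 2 * (1 - s) ^ 2 * (1 - 2 * s) ^ 2 / 36 := by
    unfold G W
    ring
  have h : 0 ≤ s ^ 2 * (1 - s) ^ 2 * (1 - 2 * s) ^ 2 / 36 := by positivity
  linarith

/-! ### The energy density -/

/-- The integrand of the surface energy. -/
def density {n : ℕ} (ε : ℝ) (φ : Space n → ℝ) (x : Space n) : ℝ :=
  ε * ‖gradient φ x‖ ^ 2 / 2 + W (φ x) / (2 * ε)

section
variable {n : ℕ} {ε : ℝ} {φ : Space n → ℝ}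

lemma surfaceEnergy_eq : surfaceEnergy ε φ = ∫ x in cell n, density ε φ x := rfl

lemma density_nonneg (hε : 0 < ε) (x : Space n) : 0 ≤ density ε φ x := by
  have := W_nonneg (φ x)
  unfold density
  positivity

lemma density_eq (ε : ℝ) (φ : Space n → ℝ) (x : Space n) :
    density ε φ x = ε / 2 * ∑ i, pd i φ x * pd i φ x + 1 / (2 * ε) * W (φ x) := by
  rw [density, norm_gradient_sq]
  simp only [sq]
  ring

lemma surfaceEnergy_nonneg (hε : 0 < ε) : 0 ≤ surfaceEnergy ε φ :=
  integral_cell_nonneg (density_nonneg hε)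

lemma continuous_density (hφ : ContDiff ℝ 1 φ) : Continuous (density ε φ) := by
  have h1 := fun i => continuous_pd hφ i
  have h2 : Continuous W := contDiff_W.continuous (n := 0)
  have h3 := hφ.continuous
  rw [show density ε φ = _ from funext (density_eq ε φ)]
  fun_prop

lemma W_div_le_density (hε : 0 < ε) (x : Space n) : W (φ x) / (2 * ε) ≤ density ε φ x := by
  have : 0 ≤ ε * ‖gradient φ x‖ ^ 2 / 2 := by positivity
  unfold density
  linarith

lemma pd_mul_pd_le_density (hε : 0 < ε) (i j : Fin n) (x : Space n) :
    |ε * (pd i φ x * pd j φ x)| ≤ 2 * density ε φ x := by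
  have h1 : |pd i φ x| * |pd j φ x| ≤ ‖gradient φ x‖ * ‖gradient φ x‖ :=
    mul_le_mul (abs_pd_le φ i x) (abs_pd_le φ j x) (abs_nonneg _) (norm_nonneg _)
  have h2 : 0 ≤ W (φ x) / (2 * ε) := div_nonneg (W_nonneg _) (by positivity)
  rw [abs_mul, abs_mul, abs_of_pos hε]
  have := mul_le_mul_of_nonneg_left h1 hε.le
  unfold density
  linarith

/-- The Modica-Mortola trick: the gradient of `G(φ)` is a product of the square roots of the two
parts of the density, so Young's inequality bounds it independently of `ε`. -/
lemma pd_G_le_density (hε : 0 < ε) (i : Fin n) (x : Space n) :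
    |φ x * (1 - φ x) * pd i φ x| ≤ 2 * density ε φ x := by
  have h1 := abs_pd_le φ i x
  have h2 : W (φ x) / (2 * ε) = |φ x * (1 - φ x)| ^ 2 / (4 * ε) := by
    rw [sq_abs, W]
    field_simp
    ring
  rw [abs_mul, density, h2]
  set a := |φ x * (1 - φ x)|
  set b := ‖gradient φ x‖
  have ha : 0 ≤ a := abs_nonneg _
  have h3 : a * |pd i φ x| ≤ a * b := mul_le_mul_of_nonneg_left h1 ha
  have h4 : 2 * (ε * b ^ 2 / 2 + a ^ 2 / (4 * ε)) - a * b
      = ((2 * ε * b - a) ^ 2 + a ^ 2) / (4 * ε) := by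
    field_simp
    ring
  have h5 : 0 ≤ ((2 * ε * b - a) ^ 2 + a ^ 2) / (4 * ε) := by
    positivity
  linarith

end

/-- The Cauchy-Schwarz inequality on the cell. -/
lemma sq_integral_cell_mul_le {n : ℕ} {f g : Space n → ℝ} (hf : Continuous f)
    (hg : Continuous g) :
    (∫ x in cell n, f x * g x) ^ 2 ≤ (∫ x in cell n, f x ^ 2) * ∫ x in cell n, g x ^ 2 := by
  have h : ∀ t : ℝ, 0 ≤ (∫ x in cell n, f x ^ 2) * (t * t)
      + (2 * ∫ x in cell n, f x * g x) * t + ∫ x in cell n, g x ^ 2 := by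
    intro t
    have e : ∫ x in cell n, (t * f x + g x) ^ 2 = (∫ x in cell n, f x ^ 2) * (t * t)
        + (2 * ∫ x in cell n, f x * g x) * t + ∫ x in cell n, g x ^ 2 := by
      have : ∀ x, (t * f x + g x) ^ 2 = (t * t * f x ^ 2 + 2 * t * (f x * g x)) + g x ^ 2 :=
        fun x => by ring
      simp_rw [this]
      rw [integral_cell_add (by fun_prop) (by fun_prop),
        integral_cell_add (by fun_prop) (by fun_prop), integral_const_mul, integral_const_mul]
      ring
    rw [← e]
    exact integral_cell_nonneg fun x => sq_nonneg _
  have := discrim_le_zero h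
  rw [discrim] at this
  nlinarith

/-- The first variation of the surface energy is the divergence of the stress tensor. -/
lemma integral_stress {n : ℕ} {ε : ℝ} {φ θ : Space n → ℝ} (hφ : ContDiff ℝ 2 φ)
    (hpφ : IsPeriodic φ) (hθ : ContDiff ℝ 1 θ) (hpθ : IsPeriodic θ) (i : Fin n) :
    ∫ x in cell n, (ε * (Laplacian.laplacian φ : Space n → ℝ) x
        - φ x * (1 - φ x) * (1 - 2 * φ x) / (2 * ε)) * pd i φ x * θ x
      = ∫ x in cell n, (density ε φ x * pd i θ x
        - ∑ j, ε * (pd j φ x * pd i φ x) * pd j θ x) := by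
  have hφ1 : ContDiff ℝ 1 φ := hφ.of_le (by norm_num)
  have hd : ContDiff ℝ 1 (density ε φ) := by
    have h1 := fun i => contDiff_pd hφ i
    have h2 : ContDiff ℝ 1 W := contDiff_W
    rw [show density ε φ = _ from funext (density_eq ε φ)]
    refine ContDiff.add (ContDiff.mul contDiff_const (ContDiff.sum fun j _ => (h1 j).mul (h1 j)))
      (contDiff_const.mul (h2.comp hφ1))
  have hpd : IsPeriodic (density ε φ) := by
    intro j x
    have h1 : ∀ i, pd i φ (x + EuclideanSpace.single j 1) = pd i φ x := fun i => hpφ.pd i j x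
    simp only [density_eq, h1, hpφ j x]
  have hdif : ∀ {f : Space n → ℝ} (x : Space n), ContDiff ℝ 1 f → DifferentiableAt ℝ f x :=
    fun x hf => hf.differentiable one_ne_zero x
  have hgrad : ∀ x, pd i (density ε φ) x = ε * ∑ j, pd j φ x * pd i (pd j φ) x
      + φ x * (1 - φ x) * (1 - 2 * φ x) / (2 * ε) * pd i φ x := by
    intro x
    have h1 : HasFDerivAt (density ε φ) ((ε / 2) • ∑ j, (pd j φ x • fderiv ℝ (pd j φ) x
        + pd j φ x • fderiv ℝ (pd j φ) x)
        + (1 / (2 * ε)) • ((φ x * (1 - φ x) * (1 - 2 * φ x)) • fderiv ℝ φ x)) x := by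
      rw [show density ε φ = _ from funext (density_eq ε φ)]
      refine ((HasFDerivAt.fun_sum fun j _ => ?_).const_mul (ε / 2)).add
        (((hasDerivAt_W (φ x)).comp_hasFDerivAt x (hdif x hφ1).hasFDerivAt).const_mul _)
      exact ((hdif x (contDiff_pd hφ j)).hasFDerivAt).mul (hdif x (contDiff_pd hφ j)).hasFDerivAt
    rw [pd, h1.fderiv]
    simp only [add_apply, FunLike.coe_smul, Pi.smul_apply, smul_eq_mul,
      sum_apply, Finset.mul_sum]
    congr 1
    · refine Finset.sum_congr rfl fun j _ => ?_
      simp only [pd]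
      ring
    · simp only [pd]
      ring
  have hF : ∀ j, ContDiff ℝ 1 fun x => pd j φ x * pd i φ x * θ x := fun j =>
    ((contDiff_pd hφ j).mul (contDiff_pd hφ i)).mul hθ
  have hpF : ∀ j, IsPeriodic fun x => pd j φ x * pd i φ x * θ x := fun j =>
    ((hpφ.pd j).mul (hpφ.pd i)).mul hpθ
  -- Pointwise, the two integrands differ by the divergence of a periodic field, whose integral
  -- vanishes. The second derivatives cancel by their symmetry.
  have key : ∀ x, (ε * (Laplacian.laplacian φ : Space n → ℝ) x
        - φ x * (1 - φ x) * (1 - 2 * φ x) / (2 * ε)) * pd i φ x * θ x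
      - (density ε φ x * pd i θ x - ∑ j, ε * (pd j φ x * pd i φ x) * pd j θ x)
      = ε * ∑ j, pd j (fun y => pd j φ y * pd i φ y * θ y) x
        - pd i (fun y => density ε φ y * θ y) x := by
    intro x
    have e1 : ∀ j, pd j (fun y => pd j φ y * pd i φ y * θ y) x
        = pd j φ x * pd i φ x * pd j θ x + (pd j φ x * pd i (pd j φ) x
          + pd j (pd j φ) x * pd i φ x) * θ x := by
      intro j
      rw [pd_mul (hdif x ((contDiff_pd hφ j).mul (contDiff_pd hφ i))) (hdif x hθ),
        pd_mul (hdif x (contDiff_pd hφ j)) (hdif x (contDiff_pd hφ i)), pd_comm hφ j i]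
    rw [pd_mul (hdif x hd) (hdif x hθ), hgrad, laplacian_eq_sum_pd hφ]
    simp_rw [e1, add_mul, Finset.sum_add_distrib, ← Finset.sum_mul]
    have e2 : ∑ j, ε * (pd j φ x * pd i φ x) * pd j θ x
        = ε * ∑ j, pd j φ x * pd i φ x * pd j θ x := by
      rw [Finset.mul_sum]
      exact Finset.sum_congr rfl fun j _ => by ring
    rw [e2]
    ring
  have hcφ := hφ.continuous
  have hcθ := hθ.continuous
  have hc1 := fun j => continuous_pd hφ1 j
  have hc2 := fun j => continuous_pd (contDiff_pd hφ j) j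
  have hc3 := fun j => continuous_pd hθ j
  have hc4 := hd.continuous
  have hc5 := fun j => continuous_pd (hF j) j
  have hc6 := continuous_pd (hd.mul hθ) i
  have h0 : ∫ x in cell n, (ε * ∑ j, pd j (fun y => pd j φ y * pd i φ y * θ y) x
        - pd i (fun y => density ε φ y * θ y) x) = 0 := by
    rw [integral_cell_sub (by fun_prop) (by fun_prop), integral_const_mul,
      integral_cell_sum _ fun j _ => hc5 j, integral_pd (hd.mul hθ) (hpd.mul hpθ)]
    simp [integral_pd (hF _) (hpF _)]
  rw [← sub_eq_zero, ← h0, ← integral_cell_sub]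
  · exact integral_congr_ae (Filter.Eventually.of_forall key)
  · simp_rw [laplacian_eq_sum_pd hφ]
    fun_prop
  · fun_prop

/-! ### The estimate of the multiplier at a fixed time -/

section
variable {n : ℕ} {ε : ℝ} {φ : Space n → ℝ}

lemma pd_G (hφ : ContDiff ℝ 1 φ) (i : Fin n) (x : Space n) :
    pd i (fun y => G (φ y)) x = φ x * (1 - φ x) * pd i φ x :=
  pd_comp (hφ.differentiable one_ne_zero x) (hasDerivAt_G _) i

/-- Lower bound of the volume of the phases tested with the divergence. -/
lemma integral_G_mul_ge (hε : 0 < ε) (hφ : ContDiff ℝ 1 φ)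
    (h01 : ∀ x, 0 ≤ φ x ∧ φ x ≤ 1) {f : Space n → ℝ} (hf : Continuous f) {δ : ℝ} (hδ : 0 ≤ δ)
    (hfG : ∫ x in cell n, |f x - G (φ x)| ≤ δ * ∑ i, ∫ x in cell n, |pd i (fun y => G (φ y)) x|) :
    intG φ / 6 - 4 / 9 * ε * surfaceEnergy ε φ - n / 3 * δ * surfaceEnergy ε φ ≤
      ∫ x in cell n, G (φ x) * f x := by
  have hcG : Continuous fun x => G (φ x) := (contDiff_G.continuous (n := 0)).comp hφ.continuous
  have hcW : Continuous fun x => W (φ x) := (contDiff_W.continuous (n := 0)).comp hφ.continuous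
  have hcd : Continuous (density ε φ) := continuous_density hφ
  have h1 : ∀ i : Fin n, ∫ x in cell n, |pd i (fun y => G (φ y)) x| ≤ 2 * surfaceEnergy ε φ := by
    intro i
    rw [surfaceEnergy_eq, ← integral_const_mul]
    refine integral_cell_mono (continuous_pd (contDiff_G.comp hφ) i).abs (by fun_prop) fun x => ?_
    rw [pd_G hφ]
    exact pd_G_le_density hε i x
  have h2 : ∑ i : Fin n, ∫ x in cell n, |pd i (fun y => G (φ y)) x|
      ≤ n * (2 * surfaceEnergy ε φ) := by
    refine (Finset.sum_le_sum fun i _ => h1 i).trans_eq ?_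
    simp
  have h3 := hfG.trans (mul_le_mul_of_nonneg_left h2 hδ)
  have h4 : ∫ x in cell n, (G (φ x) / 6 - 4 / 9 * ε * density ε φ x - |f x - G (φ x)| / 6) ≤
      ∫ x in cell n, G (φ x) * f x := by
    refine integral_cell_mono (by fun_prop) (by fun_prop) fun x => ?_
    have a1 := G_sub_W_le_G_sq (s := φ x)
    have a2 := W_div_le_density (φ := φ) hε x
    rw [div_le_iff₀ (by positivity)] at a2
    have a3 : |G (φ x) * (f x - G (φ x))| ≤ 1 / 6 * |f x - G (φ x)| := by
      rw [abs_mul]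
      exact mul_le_mul_of_nonneg_right (abs_G_le (h01 x).1 (h01 x).2) (abs_nonneg _)
    have a4 := neg_abs_le (G (φ x) * (f x - G (φ x)))
    nlinarith
  rw [integral_cell_sub (by fun_prop) (by fun_prop),
    integral_cell_sub (by fun_prop) (by fun_prop), integral_div, integral_div,
    integral_const_mul] at h4
  rw [intG, surfaceEnergy_eq] at *
  linarith

/-- Cauchy-Schwarz with the factor `ε²` shared equally: one `ε` makes the dissipation out of `ψ²`,
the other is absorbed by the gradient part of the energy. -/
lemma integral_abs_mul_pd_sq_le (hε : 0 < ε) (hφ : ContDiff ℝ 1 φ) {ψ : Space n → ℝ}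
    (hψ : Continuous ψ) (i : Fin n) :
    (∫ x in cell n, |ε * ψ x * pd i φ x|) ^ 2 ≤
      2 * (ε * ∫ x in cell n, ψ x ^ 2) * surfaceEnergy ε φ := by
  have hc := continuous_pd hφ i
  have h1 := sq_integral_cell_mul_le (n := n) (f := fun x => |ψ x|) (g := fun x => |pd i φ x|)
    hψ.abs hc.abs
  simp only [sq_abs] at h1
  have h2 : ε * ∫ x in cell n, pd i φ x ^ 2 ≤ 2 * surfaceEnergy ε φ := by
    rw [surfaceEnergy_eq, ← integral_const_mul, ← integral_const_mul]
    refine integral_cell_mono (by fun_prop) ((continuous_density hφ).const_mul 2) fun x => ?_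
    have := pd_mul_pd_le_density (φ := φ) hε i i x
    rw [sq]
    exact (le_abs_self _).trans this
  have h3 : ∫ x in cell n, |ε * ψ x * pd i φ x|
      = ε * ∫ x in cell n, |ψ x| * |pd i φ x| := by
    rw [← integral_const_mul]
    refine integral_congr_ae (Filter.Eventually.of_forall fun x => ?_)
    simp only [abs_mul, abs_of_pos hε, mul_assoc]
  have h4 : 0 ≤ ∫ x in cell n, ψ x ^ 2 := integral_cell_nonneg fun x => sq_nonneg _
  rw [h3, mul_pow]
  calc ε ^ 2 * (∫ x in cell n, |ψ x| * |pd i φ x|) ^ 2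
      ≤ ε ^ 2 * ((∫ x in cell n, ψ x ^ 2) * ∫ x in cell n, pd i φ x ^ 2) :=
        mul_le_mul_of_nonneg_left h1 (sq_nonneg ε)
    _ = (ε * ∫ x in cell n, ψ x ^ 2) * (ε * ∫ x in cell n, pd i φ x ^ 2) := by ring
    _ ≤ (ε * ∫ x in cell n, ψ x ^ 2) * (2 * surfaceEnergy ε φ) :=
        mul_le_mul_of_nonneg_left h2 (by positivity)
    _ = _ := by ring

/-- The equation of the phase field at a fixed time, tested with `∇φ · θ`. -/
lemma abs_integral_equation_le (hε : 0 < ε) (hφ : ContDiff ℝ 2 φ) (hp : IsPeriodic φ)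
    {ψ R : Space n → ℝ} (hψ : Continuous ψ) (hR : Continuous R) {M : ℝ}
    (hM : 0 ≤ M) (hRM : ∀ x, |R x| ≤ M * |φ x * (1 - φ x)|) {θ : Space n → ℝ} (hθ : ContDiff ℝ 1 θ)
    (hpθ : IsPeriodic θ) {B B' : ℝ} (hB0 : 0 ≤ B) (hB : ∀ x, |θ x| ≤ B)
    (hB' : ∀ j x, |pd j θ x| ≤ B') (i : Fin n) {A : ℝ} (hA : 0 ≤ A)
    (hAψ : 2 * (ε * ∫ x in cell n, ψ x ^ 2) * surfaceEnergy ε φ ≤ A ^ 2) :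
    |∫ x in cell n, (-(ε * ψ x) + (ε * (Laplacian.laplacian φ : Space n → ℝ) x
        - φ x * (1 - φ x) * (1 - 2 * φ x) / (2 * ε)) + R x) * pd i φ x * θ x|
      ≤ B * A + (1 + 2 * n) * B' * surfaceEnergy ε φ + 2 * M * B * surfaceEnergy ε φ := by
  have hφ1 : ContDiff ℝ 1 φ := hφ.of_le (by norm_num)
  have hcφ := hφ.continuous
  have hcθ := hθ.continuous
  have hc := fun j => continuous_pd hφ1 j
  have hcθ' := fun j => continuous_pd hθ j
  have hcd : Continuous (density ε φ) := continuous_density hφ1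
  have hcl : Continuous (Laplacian.laplacian φ : Space n → ℝ) := by
    have hc2 := fun j => continuous_pd (contDiff_pd hφ j) j
    rw [show (Laplacian.laplacian φ : Space n → ℝ) = _ from funext (laplacian_eq_sum_pd hφ)]
    fun_prop
  have e : ∀ x, (-(ε * ψ x) + (ε * (Laplacian.laplacian φ : Space n → ℝ) x
        - φ x * (1 - φ x) * (1 - 2 * φ x) / (2 * ε)) + R x) * pd i φ x * θ x
      = (-(ε * ψ x * pd i φ x * θ x) + (ε * (Laplacian.laplacian φ : Space n → ℝ) x
        - φ x * (1 - φ x) * (1 - 2 * φ x) / (2 * ε)) * pd i φ x * θ x)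
        + R x * pd i φ x * θ x := fun x => by ring
  simp_rw [e]
  rw [integral_cell_add (by fun_prop) (by fun_prop),
    integral_cell_add (by fun_prop) (by fun_prop), integral_stress hφ hp hθ hpθ]
  have b1 : |∫ x in cell n, -(ε * ψ x * pd i φ x * θ x)| ≤ B * A := by
    have h1 := abs_le_of_sq_le_sq ((integral_abs_mul_pd_sq_le hε hφ1 hψ i).trans hAψ) hA
    calc |∫ x in cell n, -(ε * ψ x * pd i φ x * θ x)|
        ≤ ∫ x in cell n, B * |ε * ψ x * pd i φ x| := by
          refine abs_integral_cell_le (by fun_prop) fun x => ?_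
          rw [abs_neg, abs_mul _ (θ x), mul_comm B]
          exact mul_le_mul_of_nonneg_left (hB x) (abs_nonneg _)
      _ = B * ∫ x in cell n, |ε * ψ x * pd i φ x| := integral_const_mul _ _
      _ ≤ B * A := mul_le_mul_of_nonneg_left ((le_abs_self _).trans h1) hB0
  have b2 : |∫ x in cell n, (density ε φ x * pd i θ x
      - ∑ j, ε * (pd j φ x * pd i φ x) * pd j θ x)| ≤ (1 + 2 * n) * B' * surfaceEnergy ε φ := by
    rw [surfaceEnergy_eq, ← integral_const_mul]
    refine abs_integral_cell_le (by fun_prop) fun x => ?_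
    have hd := density_nonneg (φ := φ) hε x
    have c1 : |density ε φ x * pd i θ x| ≤ density ε φ x * B' := by
      rw [abs_mul, abs_of_nonneg hd]
      exact mul_le_mul_of_nonneg_left (hB' i x) hd
    have c2 : |∑ j, ε * (pd j φ x * pd i φ x) * pd j θ x| ≤ n * (2 * density ε φ x * B') := by
      refine (Finset.abs_sum_le_sum_abs _ _).trans ?_
      refine (Finset.sum_le_sum (g := fun _ => 2 * density ε φ x * B') fun j _ => ?_).trans_eq
        (by simp)
      rw [abs_mul _ (pd j θ x)]
      exact mul_le_mul (pd_mul_pd_le_density hε j i x) (hB' j x) (abs_nonneg _) (by positivity)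
    have := abs_sub (density ε φ x * pd i θ x) (∑ j, ε * (pd j φ x * pd i φ x) * pd j θ x)
    linarith
  have b3 : |∫ x in cell n, R x * pd i φ x * θ x| ≤ 2 * M * B * surfaceEnergy ε φ := by
    rw [surfaceEnergy_eq, ← integral_const_mul]
    refine abs_integral_cell_le (by fun_prop) fun x => ?_
    have c1 := pd_G_le_density (φ := φ) hε i x
    rw [abs_mul, abs_mul]
    rw [abs_mul] at c1
    calc |R x| * |pd i φ x| * |θ x| ≤ M * |φ x * (1 - φ x)| * |pd i φ x| * B := by
          gcongr
          · exact hRM x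
          · exact hB x
      _ = M * B * (|φ x * (1 - φ x)| * |pd i φ x|) := by ring
      _ ≤ M * B * (2 * density ε φ x) := by gcongr
      _ = _ := by ring
  refine (abs_add_le _ _).trans (add_le_add ((abs_add_le _ _).trans (add_le_add b1 b2)) b3)

end

/-- The three summands come from `φ_t`, the stress tensor and the forcing. The factor `1 + e²` is
the price of the mollification scale `κ/(1 + e)`, which makes `∇θ` of size `(1 + e)/κ`. -/
lemma sq_multiplier_bound_le {D e P : ℝ} (hD : 0 ≤ D) (he : 0 ≤ e) (hP : P ^ 2 = 2 * D * e)
    (l : ℝ) {κ : ℝ} (hκ : 0 < κ) (M : ℝ) :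
    (1 / 6 * P + l * ((1 + e) / (3 * κ)) * e + 2 * M * (1 / 6) * e) ^ 2 ≤
      3 * (1 + l ^ 2 / κ ^ 2) * ((1 + e ^ 2) * (D * e + (1 + M ^ 2) * e ^ 2)) := by
  have hDe := mul_nonneg hD he
  set Z := D * e + (1 + M ^ 2) * e ^ 2 with hZ
  have a1 : ∀ a b c : ℝ, (a + b + c) ^ 2 ≤ 3 * (a ^ 2 + b ^ 2 + c ^ 2) := fun a b c => by
    nlinarith [sq_nonneg (a - b), sq_nonneg (a - c), sq_nonneg (b - c)]
  have a2 : (l * ((1 + e) / (3 * κ)) * e) ^ 2 = l ^ 2 / κ ^ 2 * ((1 + e) ^ 2 / 9 * e ^ 2) := by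
    field_simp
    norm_num
  have a3 : (1 / 6 * P) ^ 2 = D * e / 18 := by
    rw [mul_pow, hP]
    ring
  have hMe : 0 ≤ M ^ 2 * e ^ 2 := by positivity
  have a4 : (1 + e) ^ 2 / 9 * e ^ 2 ≤ (1 + e ^ 2) * Z := by
    have h1 : (1 + e) ^ 2 / 9 ≤ 1 + e ^ 2 := by nlinarith [sq_nonneg (1 - e)]
    have h2 : e ^ 2 ≤ Z := by linarith
    exact mul_le_mul h1 h2 (sq_nonneg e) (by positivity)
  have a5 : D * e / 18 + (2 * M * (1 / 6) * e) ^ 2 ≤ (1 + e ^ 2) * Z := by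
    have h0 : (2 * M * (1 / 6) * e) ^ 2 = M ^ 2 * e ^ 2 / 9 := by ring
    have h1 : D * e / 18 + M ^ 2 * e ^ 2 / 9 ≤ Z := by linarith [sq_nonneg e]
    have h2 : 0 ≤ e ^ 2 * Z := by positivity
    rw [h0]
    linarith
  have a6 := mul_le_mul_of_nonneg_left a4 (by positivity : 0 ≤ l ^ 2 / κ ^ 2)
  have a7 := a1 (1 / 6 * P) (l * ((1 + e) / (3 * κ)) * e) (2 * M * (1 / 6) * e)
  rw [a2, a3] at a7
  linarith

/-- The multiplier is controlled by the energy and the dissipation. -/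
lemma exists_sq_multiplier_le (n : ℕ) {c : ℝ} (hc : 0 < c) :
    ∃ K : ℝ, 0 < K ∧ ∀ (ε S M : ℝ) (φ ψ R : Space n → ℝ), 0 < ε → 0 ≤ M → ContDiff ℝ 2 φ →
      IsPeriodic φ → (∀ x, 0 ≤ φ x ∧ φ x ≤ 1) → Continuous ψ → Continuous R →
      (∀ x, |R x| ≤ M * |φ x * (1 - φ x)|) →
      (∀ x, S * (φ x * (1 - φ x)) = -(ε * ψ x) + (ε * (Laplacian.laplacian φ : Space n → ℝ) x
        - φ x * (1 - φ x) * (1 - 2 * φ x) / (2 * ε)) + R x) →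
      4 * c ≤ intG φ * (1 / 6 - intG φ) → 4 / 9 * ε * surfaceEnergy ε φ ≤ c →
      S ^ 2 ≤ K * (1 + surfaceEnergy ε φ ^ 2) * (ε * (∫ x in cell n, ψ x ^ 2) * surfaceEnergy ε φ
        + (1 + M ^ 2) * surfaceEnergy ε φ ^ 2) := by
  -- With `δ = κ/(1 + e)` the mollification error `(n/3) δ e` equals `c · n/(n+1) · e/(1+e)`, hence
  -- is at most `c` whatever the size of `e`.
  set κ : ℝ := 3 * c / (n + 1) with hκ
  have hκ0 : 0 < κ := by positivity
  -- The summand `1` only keeps the constant positive when `n = 0`.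
  refine ⟨n ^ 2 / (4 * c ^ 2) * (3 * (1 + (1 + 2 * n) ^ 2 / κ ^ 2)) + 1, by positivity, ?_⟩
  intro ε S M φ ψ R hε hM hφ hp h01 hψ hR hRM heq hvol hsmall
  have hφ1 : ContDiff ℝ 1 φ := hφ.of_le (by norm_num)
  set e := surfaceEnergy ε φ with he
  have he0 : 0 ≤ e := surfaceEnergy_nonneg hε
  set D := ε * ∫ x in cell n, ψ x ^ 2 with hD
  have hD0 : 0 ≤ D := mul_nonneg hε.le (integral_cell_nonneg fun x => sq_nonneg _)
  set δ := κ / (1 + e) with hδ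
  have hδ0 : 0 < δ := by positivity
  have hg : ContDiff ℝ 1 fun x => G (φ x) := contDiff_G.comp hφ1
  have hpg : IsPeriodic fun x => G (φ x) := hp.comp G
  obtain ⟨f, hf, hpf, hfB, hfB', hfint, hfg⟩ :=
    exists_mollification hg hpg (fun x => abs_G_le (h01 x).1 (h01 x).2) hδ0
  obtain ⟨θ, hθ, hpθ, hθB, hθB', hdiv⟩ := exists_vectorField hf hpf hfB hfB'
  set B' := 2 * (1 / 6) / δ with hB'
  set P := √(2 * D * e) with hP
  have hP2 : P ^ 2 = 2 * D * e := Real.sq_sqrt (by positivity)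
  set X := 1 / 6 * P + (1 + 2 * n) * B' * e + 2 * M * (1 / 6) * e with hX
  have hXe : X = 1 / 6 * P + (1 + 2 * n) * ((1 + e) / (3 * κ)) * e + 2 * M * (1 / 6) * e := by
    have e1 : B' = (1 + e) / (3 * κ) := by
      rw [hB', hδ]
      field_simp
      norm_num
    rw [hX, e1]
  have hQ : ∀ i, |S * ∫ x in cell n, G (φ x) * pd i (θ i) x| ≤ X := by
    intro i
    have h1 := abs_integral_equation_le hε hφ hp hψ hR hM hRM (hθ i) (hpθ i) (by norm_num)
      (hθB i) (hθB' i) i (Real.sqrt_nonneg _) hP2.ge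
    have h2 := integral_pd_mul hg (hθ i) hpg (hpθ i) i
    have h3 : ∫ x in cell n, (-(ε * ψ x) + (ε * (Laplacian.laplacian φ : Space n → ℝ) x
        - φ x * (1 - φ x) * (1 - 2 * φ x) / (2 * ε)) + R x) * pd i φ x * θ i x
        = S * ∫ x in cell n, pd i (fun y => G (φ y)) x * θ i x := by
      rw [← integral_const_mul]
      refine integral_congr_ae (Filter.Eventually.of_forall fun x => ?_)
      simp only
      rw [← heq, pd_G hφ1]
      ring
    rw [h3, h2, mul_neg, abs_neg] at h1
    exact h1
  have hsum : ∑ i, ∫ x in cell n, G (φ x) * pd i (θ i) x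
      = (∫ x in cell n, G (φ x) * f x) - intG φ ^ 2 := by
    have hcg := hg.continuous
    have hcf := hf.continuous
    have hcθ := fun i => continuous_pd (hθ i) i
    rw [← integral_cell_sum _ (f := fun i x => G (φ x) * pd i (θ i) x)
      fun i _ => hcg.mul (hcθ i)]
    simp_rw [← Finset.mul_sum, hdiv, mul_sub]
    rw [integral_cell_sub (by fun_prop) (by fun_prop), integral_mul_const, hfint, sq]
    rfl
  -- Of the available `4c`, one `c` pays for the double-well term and one for the mollification.
  have hlow : 2 * c ≤ (∫ x in cell n, G (φ x) * f x) - intG φ ^ 2 := by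
    have h1 := integral_G_mul_ge hε hφ1 h01 hf.continuous hδ0.le hfg
    have h2 : n / 3 * δ * e ≤ c := by
      have : n / 3 * δ * e = c * (n / (n + 1)) * (e / (1 + e)) := by
        rw [hδ, hκ]
        field_simp
      rw [this]
      have a1 : (n : ℝ) / (n + 1) ≤ 1 := by
        rw [div_le_one (by positivity)]
        linarith
      have a2 : e / (1 + e) ≤ 1 := by
        rw [div_le_one (by positivity)]
        linarith
      calc c * (n / (n + 1)) * (e / (1 + e)) ≤ c * 1 * 1 := by gcongr
        _ = c := by ring
    rw [← he] at h1
    nlinarith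
  have hS : 2 * c * |S| ≤ n * X := by
    have h1 : |S * ((∫ x in cell n, G (φ x) * f x) - intG φ ^ 2)| ≤ n * X := by
      rw [← hsum, Finset.mul_sum]
      refine (Finset.abs_sum_le_sum_abs _ _).trans ?_
      refine (Finset.sum_le_sum fun i _ => hQ i).trans_eq (by simp)
    rw [abs_mul, abs_of_nonneg (by linarith : 0 ≤ (∫ x in cell n, G (φ x) * f x) - intG φ ^ 2)]
      at h1
    nlinarith [abs_nonneg S]
  have hX2 := sq_multiplier_bound_le hD0 he0 hP2 (1 + 2 * n) hκ0 M
  rw [← hXe] at hX2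
  have hS2 : S ^ 2 ≤ n ^ 2 / (4 * c ^ 2) * X ^ 2 := by
    have h1 : (2 * c * |S|) ^ 2 ≤ (n * X) ^ 2 := pow_le_pow_left₀ (by positivity) hS 2
    rw [mul_pow, sq_abs] at h1
    rw [div_mul_eq_mul_div, le_div_iff₀ (by positivity)]
    linarith
  have h1 : 0 ≤ (1 + e ^ 2) * (D * e + (1 + M ^ 2) * e ^ 2) := by positivity
  have h2 := mul_le_mul_of_nonneg_left hX2 (by positivity : 0 ≤ (n : ℝ) ^ 2 / (4 * c ^ 2))
  linarith

/-! ### The maximum principle -/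

/-- If the second derivative were negative, the minimum would also be a local maximum. The function
would then be locally constant, with vanishing second derivative. -/
lemma hasDerivAt_deriv_nonneg_of_min {f f' : ℝ → ℝ} {f'' : ℝ} (h1 : ∀ s, HasDerivAt f (f' s) s)
    (h2 : HasDerivAt f' f'' 0) (hmin : ∀ s, f 0 ≤ f s) : 0 ≤ f'' := by
  by_contra! hneg
  have hd : deriv f = f' := funext fun s => (h1 s).deriv
  have h0 : deriv f 0 = 0 :=
    IsLocalMin.deriv_eq_zero (Filter.Eventually.of_forall hmin)
  have hmax : IsLocalMax f 0 :=
    isLocalMax_of_deriv_deriv_neg (by rwa [hd, h2.deriv]) h0 (h1 0).continuousAt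
  have hconst : f =ᶠ[nhds 0] fun _ => f 0 := by
    filter_upwards [hmax] with s hs using le_antisymm hs (hmin s)
  have : f' =ᶠ[nhds 0] fun _ => 0 := by
    rw [← hd]
    simpa using hconst.deriv
  have h3 := this.deriv_eq
  rw [h2.deriv] at h3
  simp at h3
  linarith

lemma laplacian_nonneg_of_min {n : ℕ} {f : Space n → ℝ} (hf : ContDiff ℝ 2 f) {x : Space n}
    (hmin : ∀ y, f x ≤ f y) : 0 ≤ (Laplacian.laplacian f : Space n → ℝ) x := by
  rw [laplacian_eq_sum_pd hf]
  refine Finset.sum_nonneg fun i _ => ?_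
  refine hasDerivAt_deriv_nonneg_of_min (f := fun s : ℝ => f (x + s • EuclideanSpace.single i 1))
    (fun s => hasDerivAt_line (hf.of_le (by norm_num)) x _ s) ?_ fun s => by simpa using hmin _
  have := hasDerivAt_line (contDiff_pd hf i) x (EuclideanSpace.single i 1) 0
  rw [zero_smul, add_zero] at this
  exact this

/-- The weak minimum principle for periodic functions. -/
lemma nonneg_of_parabolic_supersolution {n : ℕ} {τ C : ℝ} {v : ℝ → Space n → ℝ}
    (hcont : ContinuousOn (fun p : ℝ × Space n => v p.1 p.2) (Icc 0 τ ×ˢ univ))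
    (hper : ∀ t ∈ Icc 0 τ, IsPeriodic (v t)) (hsp : ∀ t ∈ Ioc 0 τ, ContDiff ℝ 2 (v t))
    (htime : ∀ t ∈ Ioc 0 τ, ∀ x, DifferentiableAt ℝ (fun s => v s x) t)
    (hineq : ∀ t ∈ Ioc 0 τ, ∀ x, v t x < 0 →
      (Laplacian.laplacian (v t) : Space n → ℝ) x + C * v t x ≤ deriv (fun s => v s x) t)
    (h0 : ∀ x, 0 ≤ v 0 x) : ∀ t ∈ Icc 0 τ, ∀ x, 0 ≤ v t x := by
  intro t₁ ht₁ x₁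
  by_contra! hneg
  -- The exponent exceeds `C` by one so that at a negative minimum of `z` the time derivative is
  -- strictly positive. Difference quotients from the left are nonpositive there, a contradiction
  -- that also covers a minimum at the final time.
  set z : ℝ → Space n → ℝ := fun t x => Real.exp (-(C + 1) * t) * v t x with hz
  have hzc : ContinuousOn (fun p : ℝ × Space n => z p.1 p.2) (Icc 0 τ ×ˢ cube n) :=
    ContinuousOn.mul (by fun_prop) (hcont.mono (prod_mono le_rfl (subset_univ _)))
  obtain ⟨y₁, hy₁, hyper⟩ := exists_mem_cell x₁
  obtain ⟨⟨t₀, x₀⟩, ⟨ht₀, hx₀⟩, hmin⟩ := (isCompact_Icc.prod (isCompact_cube n)).exists_isMinOn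
    ⟨(t₁, y₁), ht₁, cell_subset_cube n hy₁⟩ hzc
  have hmin' : ∀ t ∈ Icc 0 τ, ∀ x, z t₀ x₀ ≤ z t x := by
    intro t ht x
    obtain ⟨y, hy, hyx⟩ := exists_mem_cell x
    have h1 : z t₀ x₀ ≤ z t y := hmin (a := (t, y)) ⟨ht, cell_subset_cube n hy⟩
    simp only [hz] at h1 ⊢
    rwa [hyx _ (hper t ht)] at h1
  have hz₁ : z t₁ x₁ < 0 := mul_neg_of_pos_of_neg (Real.exp_pos _) hneg
  have hz₀ : z t₀ x₀ < 0 := (hmin' t₁ ht₁ x₁).trans_lt hz₁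
  have hv₀ : v t₀ x₀ < 0 := by
    by_contra! h
    exact absurd (mul_nonneg (Real.exp_pos (-(C + 1) * t₀)).le h) (not_le.2 hz₀)
  have ht₀' : t₀ ∈ Ioc 0 τ := by
    refine ⟨lt_of_le_of_ne ht₀.1 ?_, ht₀.2⟩
    rintro rfl
    exact absurd (h0 x₀) (not_le.2 hv₀)
  have hΔ : 0 ≤ (Laplacian.laplacian (v t₀) : Space n → ℝ) x₀ := by
    refine laplacian_nonneg_of_min (hsp t₀ ht₀') fun y => ?_
    exact le_of_mul_le_mul_left (hmin' t₀ ht₀ y) (Real.exp_pos _)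
  have hder : HasDerivAt (fun t => z t x₀) (Real.exp (-(C + 1) * t₀) *
      (deriv (fun s => v s x₀) t₀ - (C + 1) * v t₀ x₀)) t₀ := by
    have h1 : HasDerivAt (fun t : ℝ => Real.exp (-(C + 1) * t))
        (Real.exp (-(C + 1) * t₀) * -(C + 1)) t₀ := by
      simpa using ((hasDerivAt_id t₀).const_mul (-(C + 1))).exp
    refine (h1.mul (htime t₀ ht₀' x₀).hasDerivAt).congr_deriv ?_
    ring
  have hpos : 0 < Real.exp (-(C + 1) * t₀) *
      (deriv (fun s => v s x₀) t₀ - (C + 1) * v t₀ x₀) := by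
    refine mul_pos (Real.exp_pos _) ?_
    have := hineq t₀ ht₀' x₀ hv₀
    linarith
  have hslope := (hasDerivAt_iff_tendsto_slope.1 hder).mono_left
    (nhdsWithin_mono t₀ (fun s (hs : s < t₀) => ne_of_lt hs) : nhdsWithin t₀ (Iio t₀) ≤ _)
  refine absurd (le_of_tendsto hslope ?_) (not_le.2 hpos)
  have : Ioo 0 t₀ ∈ nhdsWithin t₀ (Iio t₀) := Ioo_mem_nhdsLT ht₀'.1
  filter_upwards [this] with s hs
  rw [slope_def_field]
  exact div_nonpos_of_nonneg_of_nonpos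
    (sub_nonneg.2 (hmin' s ⟨hs.1.le, hs.2.le.trans ht₀.2⟩ x₀)) (sub_nonpos.2 hs.2.le)

/-! ### Bounds for classical solutions -/

section
variable {n : ℕ} {T ε α k : ℝ} {γ : ℝ → ℝ} {φ₀ u₀ : Space n → ℝ} {φ u : ℝ → Space n → ℝ}

lemma continuousOn_intG {S : Set ℝ} (hS : ∀ t ∈ S, ∃ K, IsCompact K ∧ K ⊆ S ∧ K ∈ nhdsWithin t S)
    (h : ContinuousOn (fun p : ℝ × Space n => φ p.1 p.2) (S ×ˢ univ)) :
    ContinuousOn (fun t => intG (φ t)) S :=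
  continuousOn_integral_cell hS ((contDiff_G.continuous (n := 0)).comp_continuousOn h)

lemma exists_compact_nhdsWithin_Ico {t : ℝ} (ht : t ∈ Ico 0 T) :
    ∃ K, IsCompact K ∧ K ⊆ Ico 0 T ∧ K ∈ nhdsWithin t (Ico 0 T) := by
  obtain ⟨b, h1, h2⟩ := exists_between ht.2
  refine ⟨Icc 0 b, isCompact_Icc, Icc_subset_Ico_right h2, ?_⟩
  rw [mem_nhdsWithin]
  exact ⟨Iio b, isOpen_Iio, h1, fun s hs => ⟨hs.2.1, hs.1.le⟩⟩

lemma IsClassicalSolution.continuousOn_nonlocalTerm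
    (h : IsClassicalSolution T ε α k γ φ₀ u₀ φ u) :
    ContinuousOn (fun t => nonlocalTerm α φ₀ (φ t)) (Ico 0 T) :=
  ContinuousOn.mul continuousOn_const ((continuousOn_intG
    (fun _ => exists_compact_nhdsWithin_Ico) h.regular_phi.continuousOn).sub continuousOn_const)

/-- The equation for the phase field in the form `φ_t = Δφ - φ (1 - φ) h`. -/
lemma IsClassicalSolution.deriv_phi (h : IsClassicalSolution T ε α k γ φ₀ u₀ φ u) (hε : 0 < ε)
    {t : ℝ} (ht : t ∈ Ioo 0 T) (x : Space n) :
    deriv (fun s => φ s x) t = (Laplacian.laplacian (φ t) : Space n → ℝ) x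
      - φ t x * (1 - φ t x) * ((1 - 2 * φ t x) / (2 * ε ^ 2)
        + (-γ (u t x) + nonlocalTerm α φ₀ (φ t)) / ε) := by
  have := h.eq_phi t ht x
  rw [deriv_G, deriv_W] at this
  field_simp
  field_simp at this
  linarith

/-- On a compact time interval the reaction coefficient is bounded, as long as `u ≥ 0`. -/
lemma IsClassicalSolution.exists_reaction_bound (h : IsClassicalSolution T ε α k γ φ₀ u₀ φ u)
    (hε : 0 < ε) (hanti : AntitoneOn γ (Ici 0)) (hγ : ∀ s, 0 ≤ s → 0 ≤ γ s) {τ : ℝ} (hτ : τ < T) :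
    ∃ B C : ℝ, 0 ≤ B ∧ 0 ≤ C ∧ (∀ t ∈ Icc 0 τ, ∀ x, |φ t x| ≤ B) ∧
      ∀ t ∈ Icc 0 τ, ∀ x, 0 ≤ u t x → |(1 - 2 * φ t x) / (2 * ε ^ 2)
        + (-γ (u t x) + nonlocalTerm α φ₀ (φ t)) / ε| ≤ C := by
  have hsub : Icc 0 τ ⊆ Ico 0 T := Icc_subset_Ico_right hτ
  obtain ⟨B, hB⟩ := exists_bound_cube h.regular_phi.continuousOn isCompact_Icc hsub
  obtain ⟨A, hA⟩ := isCompact_Icc.exists_bound_of_continuousOn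
    (h.continuousOn_nonlocalTerm.mono hsub)
  have hB' : ∀ t ∈ Icc 0 τ, ∀ x, |φ t x| ≤ max B 0 := by
    intro t ht x
    obtain ⟨y, hy, hyx⟩ := exists_mem_cell x
    rw [← hyx _ (h.regular_phi.periodic t (hsub ht))]
    exact (hB t ht y (cell_subset_cube n hy)).trans (le_max_left _ _)
  have hγ0 : 0 ≤ γ 0 := hγ 0 le_rfl
  refine ⟨max B 0, (1 + 2 * max B 0) / (2 * ε ^ 2) + (γ 0 + max A 0) / ε, le_max_right _ _,
    by positivity, hB', ?_⟩
  intro t ht x hu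
  have h1 : |1 - 2 * φ t x| ≤ 1 + 2 * max B 0 := by
    have := abs_le.1 (hB' t ht x)
    rw [abs_le]
    constructor <;> linarith [this.1, this.2]
  have h2 : |-γ (u t x) + nonlocalTerm α φ₀ (φ t)| ≤ γ 0 + max A 0 := by
    have h3 := abs_le.1 ((hA t ht).trans (le_max_left A 0))
    have h4 : γ (u t x) ≤ γ 0 := hanti (self_mem_Ici) hu hu
    have h5 := hγ _ hu
    rw [abs_le]
    constructor <;> linarith [h3.1, h3.2]
  refine (abs_add_le _ _).trans (add_le_add ?_ ?_)
  · rw [abs_div, abs_of_pos (by positivity : 0 < 2 * ε ^ 2)]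
    gcongr
  · rw [abs_div, abs_of_pos hε]
    gcongr

/-- `u` stays nonnegative as long as `φ` does. -/
lemma IsClassicalSolution.u_nonneg (h : IsClassicalSolution T ε α k γ φ₀ u₀ φ u)
    (hu₀ : ∀ x, 0 ≤ u₀ x) {τ : ℝ} (hτ : τ < T) (hφ : ∀ t ∈ Icc 0 τ, ∀ x, 0 ≤ φ t x) :
    ∀ t ∈ Icc 0 τ, ∀ x, 0 ≤ u t x := by
  have hsub : Icc 0 τ ⊆ Ico 0 T := Icc_subset_Ico_right hτ
  have hsub' : ∀ t ∈ Ioc 0 τ, t ∈ Ioo 0 T := fun t ht => ⟨ht.1, ht.2.trans_lt hτ⟩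
  refine nonneg_of_parabolic_supersolution (C := |k|)
    (h.regular_u.continuousOn.mono (prod_mono hsub le_rfl))
    (fun t ht => h.regular_u.periodic t (hsub ht))
    (fun t ht => h.regular_u.contDiff_space t (hsub' t ht))
    (fun t ht => h.regular_u.differentiableAt_time t (hsub' t ht)) ?_
    (fun x => by rw [h.initial_u]; exact hu₀ x)
  intro t ht x hneg
  rw [h.eq_u t (hsub' t ht)]
  have h1 := hφ t (Ioc_subset_Icc_self ht) x
  nlinarith [neg_le_abs k]

lemma laplacian_mul_sub_const {f : Space n → ℝ} (hf : ContDiff ℝ 2 f) (a b : ℝ) (x : Space n) :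
    (Laplacian.laplacian (fun y => a * f y - b) : Space n → ℝ) x
      = a * (Laplacian.laplacian f : Space n → ℝ) x := by
  have h1 : ∀ i, pd i (fun y => a * f y - b) = fun y => a * pd i f y := fun i => by
    ext y
    have := hf.differentiable (by norm_num) y
    simp only [pd]
    rw [fderiv_sub_const, fderiv_const_mul this]
    rfl
  have h2 : ∀ i, pd i (fun y => a * pd i f y) x = a * pd i (pd i f) x := fun i => by
    have := (contDiff_pd hf i).differentiable one_ne_zero x
    rw [pd, fderiv_const_mul this]
    rfl
  rw [laplacian_eq_sum_pd hf, laplacian_eq_sum_pd (by fun_prop), Finset.mul_sum]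
  simp_rw [h1, h2]

/-- `φ` stays positive. -/
lemma IsClassicalSolution.phi_pos (h : IsClassicalSolution T ε α k γ φ₀ u₀ φ u) (hε : 0 < ε)
    (hanti : AntitoneOn γ (Ici 0)) (hγ : ∀ s, 0 ≤ s → 0 ≤ γ s) (hu₀ : ∀ x, 0 ≤ u₀ x)
    (hφ₀ : ∀ x, 0 < φ₀ x) : ∀ t ∈ Ico 0 T, ∀ x, 0 < φ t x := by
  intro t₁ ht₁ x₁
  by_contra! hneg
  have hcont : ContinuousOn (fun p : ℝ × Space n => φ p.1 p.2) (Icc 0 t₁ ×ˢ cube n) :=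
    h.regular_phi.continuousOn.mono (prod_mono (Icc_subset_Ico_right ht₁.2) (subset_univ _))
  -- The bounds are coupled: `φ ≥ 0` gives `u ≥ 0`, but the reaction term for `φ` is controlled only
  -- while `u ≥ 0`, since nothing is known of `γ` on negative arguments. The way out is to stop at
  -- the first time `τ` at which `φ` is nonpositive somewhere; on `[0, τ]` both signs hold.
  have hZ : IsCompact ((Icc 0 t₁ ×ˢ cube n) ∩ (fun p : ℝ × Space n => φ p.1 p.2) ⁻¹' Iic 0) :=
    (isCompact_Icc.prod (isCompact_cube n)).of_isClosed_subset
      (hcont.preimage_isClosed_of_isClosed (isClosed_Icc.prod (isCompact_cube n).isClosed)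
        isClosed_Iic) inter_subset_left
  obtain ⟨y₁, hy₁, hyper⟩ := exists_mem_cell x₁
  obtain ⟨⟨τ, z⟩, ⟨⟨hτ, hz⟩, hτz⟩, hmin⟩ := hZ.exists_isMinOn (f := Prod.fst)
    ⟨(t₁, y₁), ⟨⟨ht₁.1, le_rfl⟩, cell_subset_cube n hy₁⟩, by
      simpa [hyper _ (h.regular_phi.periodic t₁ ht₁)] using hneg⟩ continuous_fst.continuousOn
  have hτT : τ < T := hτ.2.trans_lt ht₁.2
  have hsub : Icc 0 τ ⊆ Ico 0 T := Icc_subset_Ico_right hτT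
  have hsub' : ∀ t ∈ Ioc 0 τ, t ∈ Ioo 0 T := fun t ht => ⟨ht.1, ht.2.trans_lt hτT⟩
  have hbefore : ∀ t ∈ Ico 0 τ, ∀ x, 0 < φ t x := by
    intro t ht x
    by_contra! hle
    obtain ⟨y, hy, hyx⟩ := exists_mem_cell x
    have htT : t ∈ Ico 0 T := hsub ⟨ht.1, ht.2.le⟩
    have h1 : τ ≤ t := hmin (a := (t, y)) ⟨⟨⟨ht.1, ht.2.le.trans hτ.2⟩, cell_subset_cube n hy⟩, by
      simpa [hyx _ (h.regular_phi.periodic t htT)] using hle⟩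
    exact absurd ht.2 (not_lt.2 h1)
  have hτ0 : 0 < τ := by
    refine lt_of_le_of_ne hτ.1 ?_
    rintro rfl
    have h1 : φ 0 z ≤ 0 := hτz
    rw [h.initial_phi] at h1
    exact absurd (hφ₀ z) (not_lt.2 h1)
  have hφ : ∀ t ∈ Icc 0 τ, ∀ x, 0 ≤ φ t x := by
    intro t ht x
    rcases ht.2.lt_or_eq with hlt | rfl
    · exact (hbefore t ⟨ht.1, hlt⟩ x).le
    · have h1 : ContinuousWithinAt (fun s => φ s x) (Ico 0 T) t :=
        (h.regular_phi.continuousOn (t, x) ⟨hsub ht, mem_univ x⟩).comp (f := fun s => (s, x))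
          (by fun_prop) fun s hs => ⟨hs, mem_univ x⟩
      have h2 : Filter.Tendsto (fun s => φ s x) (nhdsWithin t (Iio t)) (nhds (φ t x)) := by
        refine h1.mono_left ?_
        rw [nhdsWithin_le_iff]
        filter_upwards [Ioo_mem_nhdsLT hτ0] with s hs using ⟨hs.1.le, hs.2.trans hτT⟩
      refine ge_of_tendsto h2 ?_
      filter_upwards [Ioo_mem_nhdsLT hτ0] with s hs using (hbefore s ⟨hs.1.le, hs.2⟩ x).le
  have hu := h.u_nonneg hu₀ hτT hφ
  obtain ⟨B, C, hB0, hC0, hB, hC⟩ := h.exists_reaction_bound hε hanti hγ hτT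
  have hT0 : (0 : ℝ) ∈ Ico 0 T := ⟨le_rfl, hτ0.trans hτT⟩
  have hc0 : Continuous (φ 0) := continuous_of_continuousOn_prod h.regular_phi.continuousOn hT0
  obtain ⟨w, hw, hwmin⟩ := (isCompact_cube n).exists_isMinOn ⟨z, hz⟩ hc0.continuousOn
  set m := φ 0 w with hm
  have hm0 : 0 < m := by
    rw [hm, h.initial_phi]
    exact hφ₀ w
  -- `L` dominates `(1 - φ)` times the reaction coefficient, so `exp(Lt) φ` is a supersolution of
  -- the heat equation and stays above the positive initial minimum `m`, contradicting the choice of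
  -- `τ`.
  set L := (1 + B) * C with hL
  have key := nonneg_of_parabolic_supersolution (τ := τ) (C := 0)
    (v := fun t x => Real.exp (L * t) * φ t x - m)
    ((ContinuousOn.mul (by fun_prop)
      (h.regular_phi.continuousOn.mono (prod_mono hsub le_rfl))).sub continuousOn_const)
    (fun t ht => (h.regular_phi.periodic t (hsub ht)).comp fun a => Real.exp (L * t) * a - m)
    (fun t ht => (contDiff_const.mul
      (h.regular_phi.contDiff_space t (hsub' t ht))).sub contDiff_const)
    (fun t ht x => ?_) ?_ ?_ τ ⟨hτ.1, le_rfl⟩ z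
  · have h1 : Real.exp (L * τ) * φ τ z ≤ 0 :=
      mul_nonpos_of_nonneg_of_nonpos (Real.exp_pos _).le hτz
    linarith
  · exact (((by fun_prop : DifferentiableAt ℝ (fun t => Real.exp (L * t)) t).mul
      (h.regular_phi.differentiableAt_time t (hsub' t ht) x)).sub_const m)
  · intro t ht x _
    have h1 : HasDerivAt (fun t : ℝ => Real.exp (L * t)) (Real.exp (L * t) * L) t := by
      simpa using ((hasDerivAt_id t).const_mul L).exp
    have h2 := ((h1.mul (h.regular_phi.differentiableAt_time t (hsub' t ht) x).hasDerivAt).sub_const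
      m).deriv
    have h3 : deriv (fun s => Real.exp (L * s) * φ s x - m) t = Real.exp (L * t) * L * φ t x +
      Real.exp (L * t) * deriv (fun s => φ s x) t := h2
    rw [h3, laplacian_mul_sub_const (h.regular_phi.contDiff_space t (hsub' t ht)),
      h.deriv_phi hε (hsub' t ht)]
    have ht' := Ioc_subset_Icc_self ht
    have h4 := hC t ht' x (hu t ht' x)
    set H := (1 - 2 * φ t x) / (2 * ε ^ 2) + (-γ (u t x) + nonlocalTerm α φ₀ (φ t)) / ε
    have h5 : (1 - φ t x) * H ≤ L := by
      have h6 : |1 - φ t x| ≤ 1 + B := by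
        have := abs_le.1 (hB t ht' x)
        rw [abs_le]
        constructor <;> linarith [this.1, this.2]
      refine (le_abs_self _).trans ?_
      rw [abs_mul]
      exact mul_le_mul h6 h4 (abs_nonneg _) (by positivity)
    have h7 := mul_nonneg (mul_nonneg (Real.exp_pos (L * t)).le (hφ t ht' x)) (sub_nonneg.2 h5)
    linarith
  · intro x
    obtain ⟨y, hy, hyx⟩ := exists_mem_cell x
    have h1 : m ≤ φ 0 y := hwmin (cell_subset_cube n hy)
    rw [hyx _ (h.regular_phi.periodic 0 hT0)] at h1
    simpa using h1

lemma IsClassicalSolution.u_nonneg_of_nonneg (h : IsClassicalSolution T ε α k γ φ₀ u₀ φ u)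
    (hε : 0 < ε) (hanti : AntitoneOn γ (Ici 0)) (hγ : ∀ s, 0 ≤ s → 0 ≤ γ s)
    (hu₀ : ∀ x, 0 ≤ u₀ x) (hφ₀ : ∀ x, 0 < φ₀ x) : ∀ t ∈ Ico 0 T, ∀ x, 0 ≤ u t x := fun t ht =>
  h.u_nonneg hu₀ ht.2 (fun s hs x => (h.phi_pos hε hanti hγ hu₀ hφ₀ s ⟨hs.1, hs.2.trans_lt ht.2⟩
    x).le) t ⟨ht.1, le_rfl⟩

/-- `φ` stays below one. -/
lemma IsClassicalSolution.phi_le_one (h : IsClassicalSolution T ε α k γ φ₀ u₀ φ u) (hε : 0 < ε)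
    (hanti : AntitoneOn γ (Ici 0)) (hγ : ∀ s, 0 ≤ s → 0 ≤ γ s) (hu₀ : ∀ x, 0 ≤ u₀ x)
    (hφ₀ : ∀ x, 0 < φ₀ x ∧ φ₀ x < 1) : ∀ t ∈ Ico 0 T, ∀ x, φ t x ≤ 1 := by
  intro τ hτ x₁
  have hsub : Icc 0 τ ⊆ Ico 0 T := Icc_subset_Ico_right hτ.2
  have hsub' : ∀ t ∈ Ioc 0 τ, t ∈ Ioo 0 T := fun t ht => ⟨ht.1, ht.2.trans_lt hτ.2⟩
  have hu := h.u_nonneg_of_nonneg hε hanti hγ hu₀ fun x => (hφ₀ x).1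
  obtain ⟨B, C, hB0, hC0, hB, hC⟩ := h.exists_reaction_bound hε hanti hγ hτ.2
  -- This is `1 - φ`, written in the shape required by `laplacian_mul_sub_const`. Its reaction term
  -- is `φ` times the bounded coefficient times `1 - φ` itself.
  have key := nonneg_of_parabolic_supersolution (τ := τ) (C := B * C)
    (v := fun t x => -1 * φ t x - (-1))
    ((ContinuousOn.mul continuousOn_const
      (h.regular_phi.continuousOn.mono (prod_mono hsub le_rfl))).sub continuousOn_const)
    (fun t ht => (h.regular_phi.periodic t (hsub ht)).comp fun a => -1 * a - (-1))
    (fun t ht => (contDiff_const.mul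
      (h.regular_phi.contDiff_space t (hsub' t ht))).sub contDiff_const)
    (fun t ht x => ((h.regular_phi.differentiableAt_time t (hsub' t ht) x).const_mul
      (-1)).sub_const _) ?_ ?_ τ ⟨hτ.1, le_rfl⟩ x₁
  · linarith
  · intro t ht x hneg
    have h2 : deriv (fun s => -1 * φ s x - (-1)) t = -1 * deriv (fun s => φ s x) t :=
      (((h.regular_phi.differentiableAt_time t (hsub' t ht) x).hasDerivAt.const_mul
        (-1)).sub_const (-1)).deriv
    rw [h2, laplacian_mul_sub_const (h.regular_phi.contDiff_space t (hsub' t ht)),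
      h.deriv_phi hε (hsub' t ht)]
    have ht' := Ioc_subset_Icc_self ht
    have h4 := hC t ht' x (hu t (hsub ht') x)
    set H := (1 - 2 * φ t x) / (2 * ε ^ 2) + (-γ (u t x) + nonlocalTerm α φ₀ (φ t)) / ε
    have h5 : φ t x * H ≤ B * C := by
      refine (le_abs_self _).trans ?_
      rw [abs_mul]
      exact mul_le_mul (hB t ht' x) h4 (abs_nonneg _) hB0
    nlinarith
  · intro x
    have := (hφ₀ x).2
    simp only [h.initial_phi]
    linarith

end

/-! ### Differentiation of the energy -/

lemma exists_Icc_subset_Ioo {T t : ℝ} (ht : t ∈ Ioo 0 T) :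
    ∃ a b, Icc a b ⊆ Ioo 0 T ∧ Icc a b ∈ nhds t ∧ t ∈ Icc a b := by
  obtain ⟨a, ha, hat⟩ := exists_between ht.1
  obtain ⟨b, htb, hb⟩ := exists_between ht.2
  exact ⟨a, b, fun s hs => ⟨ha.trans_le hs.1, hs.2.trans_lt hb⟩, Icc_mem_nhds hat htb,
    ⟨hat.le, htb.le⟩⟩

lemma hasDerivAt_integral_cell {n : ℕ} {T : ℝ} {F F' : ℝ × Space n → ℝ}
    (hF : ContinuousOn F (Ioo 0 T ×ˢ univ)) (hF' : ContinuousOn F' (Ioo 0 T ×ˢ univ))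
    (hd : ∀ t ∈ Ioo 0 T, ∀ x, HasDerivAt (fun s => F (s, x)) (F' (t, x)) t) {t : ℝ}
    (ht : t ∈ Ioo 0 T) :
    HasDerivAt (fun t => ∫ x in cell n, F (t, x)) (∫ x in cell n, F' (t, x)) t := by
  obtain ⟨a, b, hsub, hnhds, -⟩ := exists_Icc_subset_Ioo ht
  obtain ⟨B, hB⟩ := exists_bound_cube hF' isCompact_Icc hsub
  refine (hasDerivAt_integral_of_dominated_loc_of_deriv_le (bound := fun _ => B) hnhds
    (F := fun t x => F (t, x)) (F' := fun t x => F' (t, x)) ?_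
    (continuous_of_continuousOn_prod hF ht).integrableOn_cell
    (continuous_of_continuousOn_prod hF' ht).aestronglyMeasurable ?_ (by simp) ?_).2
  · filter_upwards [hnhds] with s hs
    exact (continuous_of_continuousOn_prod hF (hsub hs)).aestronglyMeasurable
  · filter_upwards [ae_restrict_mem (measurableSet_cell n)] with x hx s hs
    exact hB s hs x (cell_subset_cube n hx)
  · exact Filter.Eventually.of_forall fun x s hs => hd s (hsub hs) x

lemma integral_sum_pd_mul_pd {n : ℕ} {f g : Space n → ℝ} (hf : ContDiff ℝ 1 f)
    (hg : ContDiff ℝ 2 g) (hpf : IsPeriodic f) (hpg : IsPeriodic g) :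
    ∫ x in cell n, ∑ i, pd i f x * pd i g x
      = -∫ x in cell n, f x * (Laplacian.laplacian g : Space n → ℝ) x := by
  have hcf := hf.continuous
  have hc1 := fun i => continuous_pd hf i
  have hc2 := fun i => (contDiff_pd hg i).continuous
  have hc3 := fun i => continuous_pd (contDiff_pd hg i) i
  simp_rw [laplacian_eq_sum_pd hg, Finset.mul_sum]
  rw [integral_cell_sum _ (f := fun i x => pd i f x * pd i g x) fun i _ => (hc1 i).mul (hc2 i),
    integral_cell_sum _ (f := fun i x => f x * pd i (pd i g) x) fun i _ => hcf.mul (hc3 i),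
    ← Finset.sum_neg_distrib]
  exact Finset.sum_congr rfl fun i _ => integral_pd_mul hf (contDiff_pd hg i) hpf (hpg.pd i) i

/-- Polarization followed by integration by parts; the mixed terms cancel. It makes the Dirichlet
energy differentiable in time without a mixed derivative `∇φ_t`, which the regularity class does not
provide. -/
lemma integral_norm_gradient_sq_sub {n : ℕ} {f g : Space n → ℝ} (hf : ContDiff ℝ 2 f)
    (hg : ContDiff ℝ 2 g) (hpf : IsPeriodic f) (hpg : IsPeriodic g) :
    (∫ x in cell n, ‖gradient f x‖ ^ 2) - ∫ x in cell n, ‖gradient g x‖ ^ 2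
      = -∫ x in cell n, (f x - g x) * ((Laplacian.laplacian f : Space n → ℝ) x
        + (Laplacian.laplacian g : Space n → ℝ) x) := by
  have hf1 : ContDiff ℝ 1 f := hf.of_le (by norm_num)
  have hg1 : ContDiff ℝ 1 g := hg.of_le (by norm_num)
  have hcl : ∀ {f : Space n → ℝ}, ContDiff ℝ 2 f →
      Continuous (Laplacian.laplacian f : Space n → ℝ) := fun {f} hf => by
    have := fun i => continuous_pd (contDiff_pd hf i) i
    rw [show (Laplacian.laplacian f : Space n → ℝ) = _ from funext (laplacian_eq_sum_pd hf)]
    fun_prop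
  have h1 := integral_sum_pd_mul_pd hf1 hf hpf hpf
  have h2 := integral_sum_pd_mul_pd hg1 hg hpg hpg
  have h3 := integral_sum_pd_mul_pd hf1 hg hpf hpg
  have h4 := integral_sum_pd_mul_pd hg1 hf hpg hpf
  have h5 : ∫ x in cell n, ∑ i, pd i g x * pd i f x = ∫ x in cell n, ∑ i, pd i f x * pd i g x := by
    simp_rw [mul_comm]
  have hc1 := hcl hf
  have hc2 := hcl hg
  have hc3 := hf.continuous
  have hc4 := hg.continuous
  have e : ∀ x, (f x - g x) * ((Laplacian.laplacian f : Space n → ℝ) x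
      + (Laplacian.laplacian g : Space n → ℝ) x)
      = ((f x * (Laplacian.laplacian f : Space n → ℝ) x
        - g x * (Laplacian.laplacian g : Space n → ℝ) x)
        + f x * (Laplacian.laplacian g : Space n → ℝ) x)
        - g x * (Laplacian.laplacian f : Space n → ℝ) x := fun x => by ring
  simp_rw [norm_gradient_sq, sq, e]
  rw [integral_cell_sub (by fun_prop) (by fun_prop), integral_cell_add (by fun_prop) (by fun_prop),
    integral_cell_sub (by fun_prop) (by fun_prop)]
  linarith

section
variable {n : ℕ} {T : ℝ} {φ : ℝ → Space n → ℝ}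

lemma IsParabolicC21.continuousOn_laplacian (h : IsParabolicC21 T φ) :
    ContinuousOn (fun p : ℝ × Space n => (Laplacian.laplacian (φ p.1) : Space n → ℝ) p.2)
      (Ioo 0 T ×ˢ univ) := by
  simp_rw [laplacian_eq_sum_iteratedFDeriv]
  refine continuousOn_finsetSum _ fun i _ => ?_
  exact (ContinuousMultilinearMap.apply ℝ (fun _ : Fin 2 => Space n) ℝ
    ![EuclideanSpace.single i 1, EuclideanSpace.single i 1]).continuous.comp_continuousOn
    h.continuousOn_hessian

lemma IsParabolicC21.continuousOn_Ioo (h : IsParabolicC21 T φ) :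
    ContinuousOn (fun p : ℝ × Space n => φ p.1 p.2) (Ioo 0 T ×ˢ univ) :=
  h.continuousOn.mono (prod_mono Ioo_subset_Ico_self le_rfl)

/-- By `integral_norm_gradient_sq_sub` the difference quotient is an integral of the quotient of `φ`
against a sum of two Laplacians. The mean value inequality bounds the quotients uniformly, so
dominated convergence applies. -/
lemma IsParabolicC21.hasDerivAt_dirichlet (h : IsParabolicC21 T φ) {t : ℝ} (ht : t ∈ Ioo 0 T) :
    HasDerivAt (fun t => ∫ x in cell n, ‖gradient (φ t) x‖ ^ 2)
      (-2 * ∫ x in cell n, (Laplacian.laplacian (φ t) : Space n → ℝ) x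
        * deriv (fun s => φ s x) t) t := by
  obtain ⟨a, b, hsub, hnhds, htab⟩ := exists_Icc_subset_Ioo ht
  obtain ⟨A, hA⟩ := exists_bound_cube h.continuousOn_laplacian isCompact_Icc hsub
  obtain ⟨B, hB⟩ := exists_bound_cube h.continuousOn_deriv_time isCompact_Icc hsub
  have hnhds' : ∀ᶠ s in nhdsWithin t {t}ᶜ, s ∈ Icc a b :=
    Filter.Eventually.filter_mono nhdsWithin_le_nhds hnhds
  rw [hasDerivAt_iff_tendsto_slope, ← integral_const_mul]
  have hlim : Filter.Tendsto (fun s => ∫ x in cell n, -(slope (fun r => φ r x) t s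
      * ((Laplacian.laplacian (φ s) : Space n → ℝ) x
        + (Laplacian.laplacian (φ t) : Space n → ℝ) x))) (nhdsWithin t {t}ᶜ)
      (nhds (∫ x in cell n, -2 * ((Laplacian.laplacian (φ t) : Space n → ℝ) x
        * deriv (fun s => φ s x) t))) := by
    refine tendsto_integral_filter_of_dominated_convergence (fun _ => B * (A + A)) ?_ ?_
      (integrable_const _) ?_
    · filter_upwards [hnhds'] with s hs
      have c1 := continuous_of_continuousOn_prod h.continuousOn_laplacian (hsub hs)
      have c2 := continuous_of_continuousOn_prod h.continuousOn_laplacian ht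
      have c3 := continuous_of_continuousOn_prod h.continuousOn_Ioo (hsub hs)
      have c4 := continuous_of_continuousOn_prod h.continuousOn_Ioo ht
      simp_rw [slope_def_field]
      exact (((c3.sub c4).div_const _).mul (c1.add c2)).neg.aestronglyMeasurable
    · filter_upwards [hnhds', self_mem_nhdsWithin] with s hs hne
      filter_upwards [ae_restrict_mem (measurableSet_cell n)] with x hx
      have hx' := cell_subset_cube n hx
      have h1 : |slope (fun r => φ r x) t s| ≤ B := by
        have := (convex_Icc a b).norm_image_sub_le_of_norm_deriv_le (f := fun r => φ r x) (C := B)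
          (fun r hr => h.differentiableAt_time r (hsub hr) x) (fun r hr => hB r hr x hx') htab hs
        rw [slope_def_field, abs_div, div_le_iff₀ (abs_pos.2 (sub_ne_zero.2 hne))]
        exact this
      rw [norm_neg, Real.norm_eq_abs, abs_mul]
      exact mul_le_mul h1 ((abs_add_le _ _).trans (add_le_add (hA s hs x hx') (hA t htab x hx')))
        (abs_nonneg _) ((abs_nonneg _).trans h1)
    · refine Filter.Eventually.of_forall fun x => ?_
      have h1 := hasDerivAt_iff_tendsto_slope.1 (h.differentiableAt_time t ht x).hasDerivAt
      have h2 : ContinuousAt (fun s => (Laplacian.laplacian (φ s) : Space n → ℝ) x) t :=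
        ((h.continuousOn_laplacian.continuousAt
          ((isOpen_Ioo.prod isOpen_univ).mem_nhds ⟨ht, mem_univ x⟩)).comp
          (f := fun s => (s, x)) (by fun_prop))
      have h3 := (h1.mul ((h2.tendsto.mono_left nhdsWithin_le_nhds).add_const
        ((Laplacian.laplacian (φ t) : Space n → ℝ) x))).neg
      convert h3 using 2
      ring
  refine hlim.congr' ?_
  filter_upwards [hnhds', self_mem_nhdsWithin] with s hs hne
  have e := integral_norm_gradient_sq_sub (h.contDiff_space s (hsub hs)) (h.contDiff_space t ht)
    (h.periodic s (Ioo_subset_Ico_self (hsub hs))) (h.periodic t (Ioo_subset_Ico_self ht))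
  rw [slope_def_field, e, integral_neg, neg_div, ← integral_div]
  congr 1
  refine integral_congr_ae (Filter.Eventually.of_forall fun x => ?_)
  simp only [slope_def_field]
  ring

lemma IsParabolicC21.hasDerivAt_integral_comp (h : IsParabolicC21 T φ) {H H' : ℝ → ℝ}
    (hH : ∀ s, HasDerivAt H (H' s) s) (hc : Continuous H') {t : ℝ} (ht : t ∈ Ioo 0 T) :
    HasDerivAt (fun t => ∫ x in cell n, H (φ t x))
      (∫ x in cell n, H' (φ t x) * deriv (fun s => φ s x) t) t := by
  have hcH : Continuous H := continuous_iff_continuousAt.2 fun s => (hH s).continuousAt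
  exact hasDerivAt_integral_cell (F := fun p => H (φ p.1 p.2))
    (F' := fun p => H' (φ p.1 p.2) * deriv (fun s => φ s p.2) p.1)
    (hcH.comp_continuousOn h.continuousOn_Ioo)
    ((hc.comp_continuousOn h.continuousOn_Ioo).mul h.continuousOn_deriv_time)
    (fun t ht x => (hH _).comp t (h.differentiableAt_time t ht x).hasDerivAt) ht

end

section
variable {n : ℕ} {T ε α k : ℝ} {γ : ℝ → ℝ} {φ₀ u₀ : Space n → ℝ} {φ u : ℝ → Space n → ℝ}

lemma surfaceEnergy_eq_add {f : Space n → ℝ} (hf : ContDiff ℝ 1 f) :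
    surfaceEnergy ε f = ε / 2 * (∫ x in cell n, ‖gradient f x‖ ^ 2)
      + 1 / (2 * ε) * ∫ x in cell n, W (f x) := by
  have h1 : Continuous fun x => ‖gradient f x‖ ^ 2 := by
    have := fun i => continuous_pd hf i
    simp_rw [norm_gradient_sq]
    fun_prop
  have h2 : Continuous fun x => W (f x) := (contDiff_W.continuous (n := 0)).comp hf.continuous
  rw [← integral_const_mul, ← integral_const_mul, ← integral_cell_add (by fun_prop) (by fun_prop)]
  refine integral_congr_ae (Filter.Eventually.of_forall fun x => ?_)
  simp only
  ring

lemma IsClassicalSolution.equation (h : IsClassicalSolution T ε α k γ φ₀ u₀ φ u) (hε : 0 < ε)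
    {t : ℝ} (ht : t ∈ Ioo 0 T) (x : Space n) :
    nonlocalTerm α φ₀ (φ t) * (φ t x * (1 - φ t x)) = -(ε * deriv (fun s => φ s x) t)
      + (ε * (Laplacian.laplacian (φ t) : Space n → ℝ) x
        - φ t x * (1 - φ t x) * (1 - 2 * φ t x) / (2 * ε))
      + γ (u t x) * (φ t x * (1 - φ t x)) := by
  rw [h.deriv_phi hε ht]
  field_simp
  ring

/-- `γ` may jump at `0`, and `u` may vanish, so continuity cannot come from composition. The
equation writes the forcing as a combination of continuous functions. -/
lemma IsClassicalSolution.continuous_forcing (h : IsClassicalSolution T ε α k γ φ₀ u₀ φ u)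
    (hε : 0 < ε) {t : ℝ} (ht : t ∈ Ioo 0 T) :
    Continuous fun x => γ (u t x) * (φ t x * (1 - φ t x)) := by
  have c1 := continuous_of_continuousOn_prod h.regular_phi.continuousOn_laplacian ht
  have c2 := continuous_of_continuousOn_prod h.regular_phi.continuousOn_deriv_time ht
  have c3 := continuous_of_continuousOn_prod h.regular_phi.continuousOn_Ioo ht
  simp only at c1 c2 c3
  have e : (fun x => γ (u t x) * (φ t x * (1 - φ t x))) = fun x =>
      nonlocalTerm α φ₀ (φ t) * (φ t x * (1 - φ t x)) + ε * deriv (fun s => φ s x) t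
      - (ε * (Laplacian.laplacian (φ t) : Space n → ℝ) x
        - φ t x * (1 - φ t x) * (1 - 2 * φ t x) / (2 * ε)) := by
    ext x
    rw [h.equation hε ht]
    ring
  rw [e]
  fun_prop

/-- Differentiation gives `∫ (-εΔφ + W'(φ)/(2ε) + S G'(φ)) φ_t`, the last term from the penalty; the
equation identifies the bracket. -/
lemma IsClassicalSolution.hasDerivAt_energy (h : IsClassicalSolution T ε α k γ φ₀ u₀ φ u)
    (hε : 0 < ε) {t : ℝ} (ht : t ∈ Ioo 0 T) :
    HasDerivAt (fun t => energy ε α φ₀ (φ t))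
      (∫ x in cell n, (γ (u t x) * (φ t x * (1 - φ t x)) - ε * deriv (fun s => φ s x) t)
        * deriv (fun s => φ s x) t) t := by
  have hr := h.regular_phi
  have c1 := continuous_of_continuousOn_prod hr.continuousOn_laplacian ht
  have c2 := continuous_of_continuousOn_prod hr.continuousOn_deriv_time ht
  have c3 := continuous_of_continuousOn_prod hr.continuousOn_Ioo ht
  simp only at c1 c2 c3
  have d1 := hr.hasDerivAt_dirichlet ht
  have d2 := hr.hasDerivAt_integral_comp hasDerivAt_W (by fun_prop) ht
  have d3 : HasDerivAt (fun t => intG (φ t)) _ t :=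
    hr.hasDerivAt_integral_comp hasDerivAt_G (by fun_prop) ht
  have d4 := ((d1.const_mul (ε / 2)).add (d2.const_mul (1 / (2 * ε)))).add
    (((d3.sub_const (intG φ₀)).pow 2).const_mul (α / 2))
  refine (d4.congr_deriv ?_).congr_of_eventuallyEq ?_
  swap
  · filter_upwards [Ioo_mem_nhds ht.1 ht.2] with s hs
    rw [energy, surfaceEnergy_eq_add ((hr.contDiff_space s hs).of_le (by norm_num)), penaltyEnergy]
    rfl
  have e : ∀ x, (γ (u t x) * (φ t x * (1 - φ t x)) - ε * deriv (fun s => φ s x) t)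
        * deriv (fun s => φ s x) t
      = (-ε * ((Laplacian.laplacian (φ t) : Space n → ℝ) x * deriv (fun s => φ s x) t)
        + 1 / (2 * ε) * (φ t x * (1 - φ t x) * (1 - 2 * φ t x) * deriv (fun s => φ s x) t))
        + nonlocalTerm α φ₀ (φ t) * (φ t x * (1 - φ t x) * deriv (fun s => φ s x) t) := by
    intro x
    have := h.equation hε ht x
    linear_combination (-deriv (fun s => φ s x) t) * this
  simp_rw [e]
  rw [integral_cell_add (by fun_prop) (by fun_prop), integral_cell_add (by fun_prop) (by fun_prop),
    integral_const_mul, integral_const_mul, integral_const_mul, nonlocalTerm]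
  simp only [Nat.cast_ofNat, Nat.reduceSub, pow_one]
  ring

lemma IsClassicalSolution.continuousOn_energy (h : IsClassicalSolution T ε α k γ φ₀ u₀ φ u) :
    ContinuousOn (fun t => energy ε α φ₀ (φ t)) (Ico 0 T) := by
  have h1 : ContinuousOn (fun p : ℝ × Space n =>
      ε * ‖gradient (φ p.1) p.2‖ ^ 2 / 2 + W (φ p.1 p.2) / (2 * ε)) (Ico 0 T ×ˢ univ) := by
    refine ContinuousOn.add ?_ ?_
    · exact ((continuousOn_const.mul (h.continuousOn_gradient_zero.norm.pow 2)).div_const 2)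
    · exact ((contDiff_W.continuous (n := 0)).comp_continuousOn
        h.regular_phi.continuousOn).div_const _
  refine ContinuousOn.add (continuousOn_integral_cell
    (fun _ => exists_compact_nhdsWithin_Ico) h1) ?_
  exact continuousOn_const.mul (((continuousOn_intG (fun _ => exists_compact_nhdsWithin_Ico)
    h.regular_phi.continuousOn).sub continuousOn_const).pow 2)

/-- The energy-dissipation inequality, with the forcing absorbed by a fraction `η` of the
dissipation. -/
lemma IsClassicalSolution.energy_deriv_le (h : IsClassicalSolution T ε α k γ φ₀ u₀ φ u)
    (hε : 0 < ε) {M : ℝ} {t : ℝ} (ht : t ∈ Ioo 0 T)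
    (hM : ∀ x, |γ (u t x) * (φ t x * (1 - φ t x))| ≤ M * |φ t x * (1 - φ t x)|) {η : ℝ}
    (hη : 0 < η) :
    ∫ x in cell n, (γ (u t x) * (φ t x * (1 - φ t x)) - ε * deriv (fun s => φ s x) t)
        * deriv (fun s => φ s x) t ≤
      -(1 - η) * (ε * ∫ x in cell n, deriv (fun s => φ s x) t ^ 2)
        + M ^ 2 / η * surfaceEnergy ε (φ t) := by
  have c2 := continuous_of_continuousOn_prod h.regular_phi.continuousOn_deriv_time ht
  have c4 := h.continuous_forcing hε ht
  have c5 : Continuous (density ε (φ t)) :=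
    continuous_density ((h.regular_phi.contDiff_space t ht).of_le (by norm_num))
  simp only at c2
  rw [surfaceEnergy_eq, ← integral_const_mul, ← integral_const_mul, ← integral_const_mul,
    ← integral_cell_add (by fun_prop) (by fun_prop)]
  refine integral_cell_mono (by fun_prop) (by fun_prop) fun x => ?_
  set R := γ (u t x) * (φ t x * (1 - φ t x))
  set ψ := deriv (fun s => φ s x) t
  have h1 : R ^ 2 ≤ M ^ 2 * (2 * W (φ t x)) := by
    have h2 := pow_le_pow_left₀ (abs_nonneg _) (hM x) 2
    rw [sq_abs, mul_pow M, sq_abs] at h2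
    refine h2.trans_eq ?_
    rw [W]
    ring
  have h2 := W_div_le_density (φ := φ t) hε x
  rw [div_le_iff₀ (by positivity)] at h2
  have h3 : R ^ 2 ≤ M ^ 2 * (4 * ε * density ε (φ t) x) := by
    refine h1.trans (mul_le_mul_of_nonneg_left ?_ (sq_nonneg M))
    linarith
  -- Young's inequality, with the weight chosen so that exactly the fraction `η` of the dissipation
  -- is used.
  have h4 : R * ψ ≤ η * ε * ψ ^ 2 + R ^ 2 / (4 * η * ε) := by
    have e : η * ε * ψ ^ 2 + R ^ 2 / (4 * η * ε) - R * ψ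
        = (2 * η * ε * ψ - R) ^ 2 / (4 * η * ε) := by
      field_simp
      ring
    have : 0 ≤ (2 * η * ε * ψ - R) ^ 2 / (4 * η * ε) := by positivity
    linarith
  have h5 : R ^ 2 / (4 * η * ε) ≤ M ^ 2 / η * density ε (φ t) x := by
    rw [div_le_iff₀ (by positivity)]
    refine h3.trans_eq ?_
    field_simp
  linarith

end

/-! ### Integration in time -/

/-- The solution is given only on `[0, T)`, so the inequality is integrated up to `b < T` and `b`
tends to `T`. The bound `B` serves integrability alone and does not enter the estimate. -/
lemma intervalIntegrable_and_integral_le {f Ψ Ψ' : ℝ → ℝ} {T Q B : ℝ} (hT : 0 < T)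
    (hf : ContinuousOn f (Ico 0 T)) (hB : ∀ t ∈ Ico 0 T, |f t| ≤ B)
    (hΨ : ContinuousOn Ψ (Ico 0 T)) (hd : ∀ t ∈ Ioo 0 T, HasDerivAt Ψ (Ψ' t) t)
    (hle : ∀ t ∈ Ioo 0 T, f t ≤ Ψ' t) (hQ : ∀ b ∈ Ioo 0 T, Ψ b - Ψ 0 ≤ Q) :
    IntervalIntegrable f volume 0 T ∧ ∫ t in (0 : ℝ)..T, f t ≤ Q := by
  have hi : IntervalIntegrable f volume 0 T := by
    rw [intervalIntegrable_iff_integrableOn_Ioo_of_le hT.le]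
    refine Integrable.of_bound (C := B)
      ((hf.mono Ioo_subset_Ico_self).aestronglyMeasurable measurableSet_Ioo) ?_
    · filter_upwards [ae_restrict_mem measurableSet_Ioo] with t ht
      exact hB t (Ioo_subset_Ico_self ht)
  refine ⟨hi, ?_⟩
  have hc := intervalIntegral.continuousOn_primitive_interval'
    (f := f) (a := 0) (b₁ := 0) (b₂ := T) hi left_mem_uIcc
  rw [uIcc_of_le hT.le] at hc
  have ht : Filter.Tendsto (fun b => ∫ t in (0 : ℝ)..b, f t) (nhdsWithin T (Iio T))
      (nhds (∫ t in (0 : ℝ)..T, f t)) := by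
    refine (hc T ⟨hT.le, le_rfl⟩).mono_left ?_
    rw [nhdsWithin_le_iff]
    filter_upwards [Ioo_mem_nhdsLT hT] with b hb using Ioo_subset_Icc_self hb
  refine le_of_tendsto ht ?_
  filter_upwards [Ioo_mem_nhdsLT hT] with b hb
  have hsub : Icc 0 b ⊆ Ico 0 T := Icc_subset_Ico_right hb.2
  refine (intervalIntegral.integral_le_sub_of_hasDeriv_right_of_le hb.1.le (hΨ.mono hsub)
    (fun t ht => (hd t ⟨ht.1, ht.2.trans hb.2⟩).hasDerivWithinAt)
    ((hf.mono hsub).integrableOn_compact isCompact_Icc)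
    fun t ht => hle t ⟨ht.1, ht.2.trans hb.2⟩).trans (hQ b hb)

/-! ### Growth of the energy, persistence of the volume bounds, scalar estimates. -/

section
variable {n : ℕ} {T ε α k : ℝ} {γ : ℝ → ℝ} {φ₀ u₀ : Space n → ℝ} {φ u : ℝ → Space n → ℝ}

lemma le_supGamma (hanti : AntitoneOn γ (Ici 0)) {s : ℝ} (hs : 0 ≤ s) : γ s ≤ supGamma γ := by
  refine le_csSup ⟨γ 0, ?_⟩ ⟨s, hs, rfl⟩
  rintro _ ⟨r, hr, rfl⟩
  exact hanti self_mem_Ici hr hr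

lemma IsClassicalSolution.abs_forcing_le (h : IsClassicalSolution T ε α k γ φ₀ u₀ φ u)
    (hε : 0 < ε) (hanti : AntitoneOn γ (Ici 0)) (hγ : ∀ s, 0 ≤ s → 0 ≤ γ s)
    (hu₀ : ∀ x, 0 ≤ u₀ x) (hφ₀ : ∀ x, 0 < φ₀ x) {t : ℝ} (ht : t ∈ Ico 0 T) (x : Space n) :
    |γ (u t x) * (φ t x * (1 - φ t x))| ≤ supGamma γ * |φ t x * (1 - φ t x)| := by
  have hu := h.u_nonneg_of_nonneg hε hanti hγ hu₀ hφ₀ t ht x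
  rw [abs_mul, abs_of_nonneg (hγ _ hu)]
  exact mul_le_mul_of_nonneg_right (le_supGamma hanti hu) (abs_nonneg _)

lemma surfaceEnergy_le_energy (hα : 0 ≤ α) (f : Space n → ℝ) :
    surfaceEnergy ε f ≤ energy ε α φ₀ f := by
  have : 0 ≤ penaltyEnergy α φ₀ f := by
    unfold penaltyEnergy
    positivity
  unfold energy
  linarith

lemma IsClassicalSolution.energy_zero (h : IsClassicalSolution T ε α k γ φ₀ u₀ φ u) :
    energy ε α φ₀ (φ 0) = surfaceEnergy ε φ₀ := by
  rw [funext h.initial_phi, energy, penaltyEnergy]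
  simp

/-- The energy grows at most like `exp (M² t)`. -/
lemma IsClassicalSolution.energy_le (h : IsClassicalSolution T ε α k γ φ₀ u₀ φ u)
    (hε : 0 < ε) (hα : 0 ≤ α) {M : ℝ}
    (hM : ∀ t ∈ Ioo 0 T, ∀ x, |γ (u t x) * (φ t x * (1 - φ t x))| ≤ M * |φ t x * (1 - φ t x)|)
    {t : ℝ} (ht : t ∈ Ico 0 T) :
    energy ε α φ₀ (φ t) ≤ Real.exp (M ^ 2 * t) * energy ε α φ₀ (φ 0) := by
  have hexp : ∀ t : ℝ, HasDerivAt (fun t : ℝ => Real.exp (-M ^ 2 * t))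
      (Real.exp (-M ^ 2 * t) * -M ^ 2) t := fun t => by
    simpa using ((hasDerivAt_id t).const_mul (-M ^ 2)).exp
  have hanti : AntitoneOn (fun t => Real.exp (-M ^ 2 * t) * energy ε α φ₀ (φ t)) (Ico 0 T) := by
    refine antitoneOn_of_deriv_nonpos (convex_Ico 0 T)
      (ContinuousOn.mul (by fun_prop) h.continuousOn_energy) ?_ ?_
    · rw [interior_Ico]
      exact fun s hs => ((hexp s).mul (h.hasDerivAt_energy hε hs)).differentiableAt
        |>.differentiableWithinAt
    · rw [interior_Ico]
      intro s hs
      refine (HasDerivAt.deriv ((hexp s).mul (h.hasDerivAt_energy hε hs))).trans_le ?_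
      -- With `η = 1` the whole dissipation is spent on absorbing the forcing, which gives the
      -- growth rate `M²`.
      have h1 := h.energy_deriv_le hε hs (hM s hs) one_pos
      have h2 := mul_le_mul_of_nonneg_left (surfaceEnergy_le_energy (ε := ε) (φ₀ := φ₀) hα (φ s))
        (sq_nonneg M)
      rw [mul_assoc, ← mul_add]
      refine mul_nonpos_of_nonneg_of_nonpos (Real.exp_pos _).le ?_
      linarith
  have h1 := hanti ⟨le_rfl, ht.1.trans_lt ht.2⟩ ht ht.1
  simp only [mul_zero, Real.exp_zero, one_mul] at h1
  calc energy ε α φ₀ (φ t)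
      = Real.exp (M ^ 2 * t) * (Real.exp (-M ^ 2 * t) * energy ε α φ₀ (φ t)) := by
        rw [← mul_assoc, ← Real.exp_add]
        simp
    _ ≤ _ := mul_le_mul_of_nonneg_left h1 (Real.exp_pos _).le

lemma sq_intG_sub_le_energy (hε : 0 < ε) (f : Space n → ℝ) :
    α / 2 * (intG f - intG φ₀) ^ 2 ≤ energy ε α φ₀ f := by
  have : 0 ≤ surfaceEnergy ε f := surfaceEnergy_nonneg hε
  unfold energy penaltyEnergy
  linarith

/-- The volume constraint is inherited from the initial datum when `α` is large. -/
lemma le_intG_mul_of_energy_le (hε : 0 < ε) (hα : 0 < α) {f : Space n → ℝ} {c X : ℝ}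
    (hc : 0 < c) (hlow : c ≤ intG φ₀) (hup : c ≤ 1 - 6 * intG φ₀)
    (hE : energy ε α φ₀ f ≤ X) (hX : 288 * X ≤ α * c ^ 2) :
    4 * (c ^ 2 / 64) ≤ intG f * (1 / 6 - intG f) := by
  have h1 : α / 2 * (intG f - intG φ₀) ^ 2 ≤ X := (sq_intG_sub_le_energy hε f).trans hE
  -- `288 = 2 · 12²`: the volume moves by at most `c/12`, half of the gap `c/6` between the initial
  -- volume and `1/6`. The product below is then at least `11c²/144`, which exceeds `c²/16`.
  have h2 : (intG f - intG φ₀) ^ 2 ≤ (c / 12) ^ 2 := by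
    refine le_of_mul_le_mul_left (a := α) ?_ hα
    linarith
  have h3 := abs_le.1 (abs_le_of_sq_le_sq h2 (by positivity))
  have h4 : 11 / 12 * c ≤ intG f := by linarith [h3.1]
  have h5 : c / 12 ≤ 1 / 6 - intG f := by linarith [h3.2]
  have h6 := mul_le_mul h4 h5 (by positivity) (by linarith)
  linarith [sq_nonneg c]

/-- Only two powers of the initial energy are kept, because the final bound is quadratic in it; the
other two go into the uniform bound `D`. -/
lemma sq_add_pow_four_le {E E₀ D M t : ℝ} (hE : 0 ≤ E) (hE₀ : 0 ≤ E₀) (hD : E₀ ≤ D)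
    (ht : 0 ≤ t) (h : E ≤ Real.exp (M ^ 2 * t) * E₀) :
    E ^ 2 + E ^ 4 ≤ (1 + D ^ 2) * (E₀ ^ 2 * Real.exp (4 * M ^ 2 * t)) := by
  set a := Real.exp (M ^ 2 * t) with ha
  have ha1 : 1 ≤ a := Real.one_le_exp (by positivity)
  have ha4 : Real.exp (4 * M ^ 2 * t) = a ^ 4 := by
    rw [ha, ← Real.exp_nat_mul]
    congr 1
    push_cast
    ring
  have h2 : E ^ 2 ≤ a ^ 4 * E₀ ^ 2 := by
    calc E ^ 2 ≤ (a * E₀) ^ 2 := pow_le_pow_left₀ hE h 2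
      _ = a ^ 2 * E₀ ^ 2 := mul_pow _ _ _
      _ ≤ a ^ 4 * E₀ ^ 2 :=
        mul_le_mul_of_nonneg_right (pow_le_pow_right₀ ha1 (by norm_num)) (sq_nonneg _)
  have h4 : E ^ 4 ≤ a ^ 4 * E₀ ^ 2 * D ^ 2 := by
    calc E ^ 4 ≤ (a * E₀) ^ 4 := pow_le_pow_left₀ hE h 4
      _ = a ^ 4 * E₀ ^ 2 * E₀ ^ 2 := by ring
      _ ≤ a ^ 4 * E₀ ^ 2 * D ^ 2 :=
        mul_le_mul_of_nonneg_left (pow_le_pow_left₀ hE₀ hD 2) (by positivity)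
  rw [ha4]
  linarith

/-- A primitive of an upper bound for `(1 + 5 M²) exp (4 M² t)`, with a constant that does not
blow up for `M = 0`. -/
lemma exists_hasDerivAt_ge (M : ℝ) : ∃ c : ℝ, 0 ≤ c ∧ ∃ j' : ℝ → ℝ,
    (∀ t, HasDerivAt (fun t => c * Real.exp (4 * M ^ 2 * t) + t) (j' t) t) ∧
      ∀ t, (1 + 5 * M ^ 2) * Real.exp (4 * M ^ 2 * t) ≤ j' t := by
  refine ⟨1 / (4 * M ^ 2) + 5 / 4, by positivity, fun t => (1 / (4 * M ^ 2) + 5 / 4) *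
    (Real.exp (4 * M ^ 2 * t) * (4 * M ^ 2)) + 1, fun t => ?_, fun t => ?_⟩
  · have h1 : HasDerivAt (fun t : ℝ => Real.exp (4 * M ^ 2 * t))
        (Real.exp (4 * M ^ 2 * t) * (4 * M ^ 2)) t := by
      simpa using ((hasDerivAt_id t).const_mul (4 * M ^ 2)).exp
    exact (h1.const_mul _).add (hasDerivAt_id t)
  -- For `M = 0` the exponential is constant and the summand `t` alone supplies the required slope
  -- `1`.
  · rcases eq_or_ne M 0 with rfl | hM
    · simp
    · have : (1 / (4 * M ^ 2) + 5 / 4) * (Real.exp (4 * M ^ 2 * t) * (4 * M ^ 2))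
          = (1 + 5 * M ^ 2) * Real.exp (4 * M ^ 2 * t) := by
        field_simp
      linarith

end

end PhaseField

end

/-! ### The main estimate. -/

open PhaseField in
theorem mainTheorem2 (n : ℕ) (hn : n = 2 ∨ n = 3) (k : ℝ)
    (γ : ℝ → ℝ) (hγ_smooth : ContDiffOn ℝ 2 γ (Set.Ioi 0))
    (hγ_anti : AntitoneOn γ (Set.Ici 0)) (hγ_nonneg : ∀ s, 0 ≤ s → 0 ≤ γ s)
    (φ₀ u₀ : ℝ → PhaseField.Space n → ℝ)
    (hφ₀_periodic : ∀ ε ∈ Set.Ioo (0 : ℝ) 1, PhaseField.IsPeriodic (φ₀ ε))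
    (hφ₀_smooth : ∀ ε ∈ Set.Ioo (0 : ℝ) 1, ContDiff ℝ 1 (φ₀ ε))
    (hφ₀_range : ∀ ε ∈ Set.Ioo (0 : ℝ) 1, ∀ x, 0 < φ₀ ε x ∧ φ₀ ε x < 1)
    (hu₀_periodic : ∀ ε ∈ Set.Ioo (0 : ℝ) 1, PhaseField.IsPeriodic (u₀ ε))
    (hu₀_cont : ∀ ε ∈ Set.Ioo (0 : ℝ) 1, Continuous (u₀ ε))
    (hu₀_nonneg : ∀ ε ∈ Set.Ioo (0 : ℝ) 1, ∀ x, 0 ≤ u₀ ε x)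
    (henergy : ∃ D : ℝ, ∀ ε ∈ Set.Ioo (0 : ℝ) 1, PhaseField.surfaceEnergy ε (φ₀ ε) ≤ D)
    (C₁ : ℝ) (hC₁ : 0 < C₁)
    (hvol_upper : ∀ ε ∈ Set.Ioo (0 : ℝ) 1,
      C₁ ≤ 1 - 6 / PhaseField.cellVolume n * PhaseField.intG (φ₀ ε))
    (hvol_lower : ∀ ε ∈ Set.Ioo (0 : ℝ) 1, C₁ ≤ PhaseField.intG (φ₀ ε)) :
    ∃ C₂ : ℝ, 0 < C₂ ∧ ∀ T : ℝ, 0 < T →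
      ∃ ε₀ : ℝ, 0 < ε₀ ∧ ε₀ ≤ 1 ∧ ∃ α₀ : ℝ, 0 < α₀ ∧
        ∀ ε : ℝ, 0 < ε → ε < ε₀ → ∀ α : ℝ, α₀ < α →
          ∀ φ u : ℝ → PhaseField.Space n → ℝ,
            PhaseField.IsClassicalSolution T ε α k γ (φ₀ ε) (u₀ ε) φ u →
            IntervalIntegrable
                (fun t => |PhaseField.nonlocalTerm α (φ₀ ε) (φ t)| ^ 2) MeasureTheory.volume 0 T ∧
              ∫ t in (0 : ℝ)..T, |PhaseField.nonlocalTerm α (φ₀ ε) (φ t)| ^ 2 ≤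
                C₂ * (1 + Real.exp (2 * PhaseField.supGamma γ ^ 2 * T)
                        * PhaseField.energy ε α (φ₀ ε) (φ 0))
                  * ((1 + PhaseField.supGamma γ ^ 2) * T
                    + 2 * Real.exp (2 * PhaseField.supGamma γ ^ 2 * T)
                        * PhaseField.energy ε α (φ₀ ε) (φ 0)) := by
  obtain ⟨D, hD⟩ := henergy
  set M := supGamma γ with hM
  have hM0 : 0 ≤ M := (hγ_nonneg 0 le_rfl).trans (le_supGamma hγ_anti le_rfl)
  have hD0 : 0 ≤ D := (surfaceEnergy_nonneg (by norm_num)).trans (hD (1 / 2) (by norm_num))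
  obtain ⟨K, hK, hmult⟩ := exists_sq_multiplier_le n (c := C₁ ^ 2 / 64) (by positivity)
  obtain ⟨c, hc, j', hj, hj'⟩ := exists_hasDerivAt_ge M
  refine ⟨K * (1 + D ^ 2) * (1 + c + D ^ 2), by positivity, fun T hT => ?_⟩
  -- `X` bounds the energy on `[0, T)` uniformly in `ε` and `α`, since the penalty vanishes
  -- initially. Only the thresholds for `ε` and `α` depend on it, hence on `T`: they make the
  -- double-well error and the change of volume small.
  set X := Real.exp (M ^ 2 * T) * D with hX
  have hX0 : 0 ≤ X := by positivity
  refine ⟨min 1 (C₁ ^ 2 / 64 / (X + 1)), by positivity, min_le_left _ _, 288 * X / C₁ ^ 2 + 1,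
    by positivity, ?_⟩
  intro ε hε hε₀ α hα φ u h
  have hε1 : ε ∈ Ioo (0 : ℝ) 1 := ⟨hε, hε₀.trans_le (min_le_left _ _)⟩
  have hεX : 4 / 9 * ε * X ≤ C₁ ^ 2 / 64 := by
    have := (hε₀.trans_le (min_le_right _ _)).le
    rw [le_div_iff₀ (by positivity)] at this
    nlinarith [mul_nonneg hε.le hX0]
  have hα0 : 0 < α := lt_trans (by positivity) hα
  have hαX : 288 * X ≤ α * C₁ ^ 2 := by
    rw [← div_le_iff₀ (by positivity)]
    linarith
  have hpos := h.phi_pos hε hγ_anti hγ_nonneg (hu₀_nonneg ε hε1) fun x => (hφ₀_range ε hε1 x).1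
  have hle1 := h.phi_le_one hε hγ_anti hγ_nonneg (hu₀_nonneg ε hε1) (hφ₀_range ε hε1)
  have hforce := fun t (ht : t ∈ Ico 0 T) => h.abs_forcing_le hε hγ_anti hγ_nonneg
    (hu₀_nonneg ε hε1) (fun x => (hφ₀_range ε hε1 x).1) ht
  have hforce' := fun t (ht : t ∈ Ioo 0 T) => hforce t (Ioo_subset_Ico_self ht)
  set E : ℝ → ℝ := fun t => energy ε α (φ₀ ε) (φ t) with hE
  set E' : ℝ → ℝ := fun t => ∫ x in cell n, (γ (u t x) * (φ t x * (1 - φ t x))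
    - ε * deriv (fun s => φ s x) t) * deriv (fun s => φ s x) t with hE'
  have hEd : ∀ t ∈ Ioo 0 T, HasDerivAt E (E' t) t := fun t ht => h.hasDerivAt_energy hε ht
  have hEc : ContinuousOn E (Ico 0 T) := h.continuousOn_energy
  have hEnonneg : ∀ t, 0 ≤ E t := fun t =>
    (surfaceEnergy_nonneg hε).trans (surfaceEnergy_le_energy hα0.le (φ t))
  have hE0 : E 0 ≤ D := h.energy_zero.trans_le (hD ε hε1)
  have hEexp : ∀ t ∈ Ico 0 T, E t ≤ Real.exp (M ^ 2 * t) * E 0 := fun t ht =>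
    h.energy_le hε hα0.le hforce' ht
  have hEX : ∀ t ∈ Ico 0 T, E t ≤ X := fun t ht => (hEexp t ht).trans (by
    rw [hX]
    have := ht.2.le
    have := hEnonneg 0
    gcongr)
  set S : ℝ → ℝ := fun t => nonlocalTerm α (φ₀ ε) (φ t) with hS
  have hSB : ∀ t ∈ Ico 0 T, |S t ^ 2| ≤ 2 * α * X := by
    intro t ht
    have h1 := mul_le_mul_of_nonneg_left
      ((sq_intG_sub_le_energy (α := α) (φ₀ := φ₀ ε) hε (φ t)).trans (hEX t ht)) hα0.le
    rw [abs_of_nonneg (sq_nonneg _), hS]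
    simp only [nonlocalTerm]
    linarith
  -- The first bracket is the derivative of `E² + E⁴/2`, in the form in which the power rule
  -- produces it.
  have hSle : ∀ t ∈ Ioo 0 T, S t ^ 2 ≤ K * (-((2 * E t * E' t) + 4 * E t ^ 3 * E' t / 2)
      + (1 + D ^ 2) * E 0 ^ 2 * j' t) := by
    intro t ht
    have ht' := Ioo_subset_Ico_self ht
    set e := surfaceEnergy ε (φ t) with he
    have he0 : 0 ≤ e := surfaceEnergy_nonneg hε
    have heE : e ≤ E t := surfaceEnergy_le_energy hα0.le (φ t)
    set A := ε * ∫ x in cell n, deriv (fun s => φ s x) t ^ 2 with hA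
    have hA0 : 0 ≤ A := mul_nonneg hε.le (integral_cell_nonneg fun x => sq_nonneg _)
    have h1 : S t ^ 2 ≤ K * (1 + e ^ 2) * (A * e + (1 + M ^ 2) * e ^ 2) := by
      refine hmult ε (S t) M (φ t) (fun x => deriv (fun s => φ s x) t)
        (fun x => γ (u t x) * (φ t x * (1 - φ t x))) hε hM0 (h.regular_phi.contDiff_space t ht)
        (h.regular_phi.periodic t ht') (fun x => ⟨(hpos t ht' x).le, hle1 t ht' x⟩)
        (continuous_of_continuousOn_prod h.regular_phi.continuousOn_deriv_time ht)
        (h.continuous_forcing hε ht) (hforce t ht') (h.equation hε ht) ?_ ?_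
      · refine le_intG_mul_of_energy_le hε hα0 hC₁ (hvol_lower ε hε1) ?_ (hEX t ht') hαX
        simpa [cellVolume_eq_one] using hvol_upper ε hε1
      · refine le_trans ?_ hεX
        have := heE.trans (hEX t ht')
        gcongr
    have h2 : K * (1 + e ^ 2) * (A * e + (1 + M ^ 2) * e ^ 2)
        ≤ K * ((1 + E t ^ 2) * (A * E t + (1 + M ^ 2) * E t ^ 2)) := by
      rw [mul_assoc]
      gcongr
    -- With `η = 1/2` half of the dissipation survives.
    have h3 : A ≤ -2 * E' t + 4 * M ^ 2 * E t := by
      have a1 := h.energy_deriv_le hε ht (hforce t ht') (η := 1 / 2) (by norm_num)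
      have a2 := mul_le_mul_of_nonneg_left heE (sq_nonneg M)
      have a3 : E' t ≤ -(1 - 1 / 2) * A + M ^ 2 / (1 / 2) * e := a1
      linarith
    have h4 : (1 + E t ^ 2) * (A * E t + (1 + M ^ 2) * E t ^ 2) ≤
        -((2 * E t * E' t) + 4 * E t ^ 3 * E' t / 2)
          + (1 + 5 * M ^ 2) * (E t ^ 2 + E t ^ 4) := by
      have a1 : 0 ≤ (1 + E t ^ 2) * E t := mul_nonneg (by positivity) (hEnonneg t)
      have a2 := mul_le_mul_of_nonneg_left h3 a1
      linarith
    have h5 := sq_add_pow_four_le (hEnonneg t) (hEnonneg 0) hE0 ht.1.le (hEexp t ht')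
    have h6 : (1 + 5 * M ^ 2) * (E t ^ 2 + E t ^ 4) ≤ (1 + D ^ 2) * E 0 ^ 2 * j' t := by
      have a1 := mul_le_mul_of_nonneg_left h5 (by positivity : 0 ≤ 1 + 5 * M ^ 2)
      have a2 := mul_le_mul_of_nonneg_left (hj' t)
        (by positivity : 0 ≤ (1 + D ^ 2) * E 0 ^ 2)
      linarith
    refine h1.trans (h2.trans (mul_le_mul_of_nonneg_left ?_ hK.le))
    linarith
  have hmain := intervalIntegrable_and_integral_le (f := fun t => S t ^ 2)
    (Ψ := fun t => K * (-(E t ^ 2 + E t ^ 4 / 2) + (1 + D ^ 2) * E 0 ^ 2 *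
      (c * Real.exp (4 * M ^ 2 * t) + t)))
    (Q := K * (1 + D ^ 2) * (1 + c + D ^ 2)
      * (1 + Real.exp (2 * M ^ 2 * T) * E 0)
        * ((1 + M ^ 2) * T + 2 * Real.exp (2 * M ^ 2 * T) * E 0))
    hT (h.continuousOn_nonlocalTerm.pow 2) hSB ?_ (fun t ht => ?_) hSle ?_
  · simp_rw [sq_abs]
    exact hmain
  · exact continuousOn_const.mul (((hEc.pow 2).add ((hEc.pow 4).div_const 2)).neg.add
      (by fun_prop))
  · have h1 := ((((hEd t ht).pow 2).add (((hEd t ht).pow 4).div_const 2)).neg.add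
      ((hj t).const_mul ((1 + D ^ 2) * E 0 ^ 2))).const_mul K
    refine h1.congr_deriv ?_
    simp
  · intro b hb
    simp only [mul_zero, Real.exp_zero, mul_one, add_zero]
    -- `2Y` is the constant `C(T)`. The increment of the primitive is bounded by multiples of `Y²`
    -- and `T`, both of which occur in the expansion of `(1 + Y)((1 + M²)T + 2Y)`.
    set Y := Real.exp (2 * M ^ 2 * T) * E 0 with hY
    have hY0 : 0 ≤ Y := mul_nonneg (Real.exp_pos _).le (hEnonneg 0)
    have hYsq : Real.exp (4 * M ^ 2 * T) * E 0 ^ 2 = Y ^ 2 := by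
      rw [hY, mul_pow, ← Real.exp_nat_mul]
      congr 2
      push_cast
      ring
    have hE0Y : E 0 ^ 2 ≤ Y ^ 2 := by
      have : E 0 ≤ Y := le_mul_of_one_le_left (hEnonneg 0) (Real.one_le_exp (by positivity))
      exact pow_le_pow_left₀ (hEnonneg 0) this 2
    have hE0D : E 0 ^ 2 ≤ D ^ 2 := pow_le_pow_left₀ (hEnonneg 0) hE0 2
    have hexp : Real.exp (4 * M ^ 2 * b) * E 0 ^ 2 ≤ Y ^ 2 := by
      rw [← hYsq]
      have := hb.2.le
      gcongr
    have h1 : E 0 ^ 2 + E 0 ^ 4 / 2 ≤ (1 + D ^ 2) * Y ^ 2 := by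
      have a1 := mul_le_mul hE0D hE0Y (sq_nonneg _) (sq_nonneg _)
      have a2 : 0 ≤ D ^ 2 * Y ^ 2 := by positivity
      linarith
    have h2 : E 0 ^ 2 * (c * Real.exp (4 * M ^ 2 * b) + b) ≤ c * Y ^ 2 + D ^ 2 * T := by
      have a1 := mul_le_mul_of_nonneg_left hexp hc
      have a2 := mul_le_mul hE0D hb.2.le hb.1.le (sq_nonneg _)
      linarith
    have h3 : 0 ≤ (1 + D ^ 2) * (E 0 ^ 2 * c) := by positivity
    have h4 := mul_le_mul_of_nonneg_left h2 (by positivity : 0 ≤ 1 + D ^ 2)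
    have h5 : 0 ≤ E b ^ 2 + E b ^ 4 / 2 := by positivity
    have h6 : (1 + c + D ^ 2) * (Y ^ 2 + T)
        ≤ (1 + c + D ^ 2) * ((1 + Y) * ((1 + M ^ 2) * T + 2 * Y)) := by
      refine mul_le_mul_of_nonneg_left ?_ (by positivity)
      have : 0 ≤ M ^ 2 * T + Y * (1 + M ^ 2) * T + 2 * Y + Y ^ 2 := by positivity
      linarith
    have h7 : Y ^ 2 + (c * Y ^ 2 + D ^ 2 * T) ≤ (1 + c + D ^ 2) * (Y ^ 2 + T) := by
      have : 0 ≤ T + c * T + D ^ 2 * Y ^ 2 := by positivity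
      linarith
    have h8 := mul_le_mul_of_nonneg_left (h7.trans h6) (by positivity : 0 ≤ 1 + D ^ 2)
    rw [← mul_sub, mul_assoc K, mul_assoc K, mul_assoc K, mul_assoc 2]
    refine mul_le_mul_of_nonneg_left ?_ hK.le
    linarith
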